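/- Let $\{T(x,t):(x,t)\in\mathbb S^2\times\mathbb Z\}$ be a real-valued, zero-mean random field on a probability space $(\Omega,\mathfrak F,\mathbb P)$, jointly measurable in $(x,\omega)$ for every $t$, with $\mathbb E|T(x,t)|^2<\infty$, which is isotropic stationary: $\mathbb E[T(x,t)T(y,s)]=\mathbb E[T(gx,t+h)T(gy,s+h)]$ for all $x,y\in\mathbb S^2$, $g\in SO(3)$, $t,s,h\in\mathbb Z$. Let $dx$ be the surface measure of $\mathbb S^2$ (total mass $4\pi$) and $\langle f,g\rangle_2=\int_{\mathbb S^2} f(x)\overline{g(x)}\,dx$ on $L^2(\mathbb S^2;\mathbb C)$. Assume that the autocovariance kernels $r_t(x,y)=\mathbb E[T(x,t)T(y,0)]$ are continuous on $\mathbb S^2\times\mathbb S^2$ and that the operators $(\mathscr R_t h)(x)=\int_{\mathbb S^2}r_t(x,y)h(y)\,dy$ on $L^2(\mathbb S^2;\mathbb C)$ satisfy $\sum_{t\in\mathbb Z}\|\mathscr R_t\|_{\mathrm{TR}}<\infty$, where $\|\cdot\|_{\mathrm{TR}}$ is the trace norm. Let $\{Y_{\ell,m}:\ell\ge 0,\ -\ell\le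 m\le \ell\}$ be orthonormal in $L^2(\mathbb S^2;\mathbb C)$, each $Y_{\ell,m}$ being a spherical harmonic of degree $\ell$ (the restriction to $\mathbb S^2$ of a homogeneous harmonic polynomial of degree $\ell$). Put $a_{\ell,m}(t)=\int_{\mathbb S^2}T(x,t)\overline{Y_{\ell,m}(x)}\,dx$, $C_\ell(t)=\mathbb E[a_{\ell,m}(t)\overline{a_{\ell,m}(0)}]$ (which does not depend on $m$; take $m=0$) and $f_\ell(\lambda)=\frac1{2\pi}\sum_{t\in\mathbb Z}e^{-it\lambda}C_\ell(t)$. Let $T_t$ be the random element of $L^2(\mathbb S^2)$ given by $T(\cdot,t)$. For $g:[-\pi,\pi]\to\mathbb C$ and a process $X_\lambda$, $-\pi\le\lambda\le\pi$, with values in $E=\mathbb C$ or $E=L^2(\mathbb S^2;\mathbb C)$, a square-integrable $E$-valued random element $I$ is written $I=\int_{-\pi}^{\pi}g(\lambda)\,dX_\lambda$ if $$\mathbb E\Big\|I-\sum_{j=1}^J g(\lambda_j)(X_{\lambda_{j+1}}-X_{\lambda_j})\Big\|_E^2\to0$$ as the mesh of the partition $-\pi=\lambda_1<\dots<\lambda_{J+1}=\pi$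 tends to $0$. Call a process $\{Z_\lambda:-\pi\le\lambda\le\pi\}$ of square-integrable random elements of $L^2(\mathbb S^2;\mathbb C)$ a Cramér process of $T$ if $\mathbb E\|Z_\lambda\|_2^2=\sum_{\ell\ge0}(2\ell+1)\int_{-\pi}^{\lambda}f_\ell(\nu)\,d\nu$ for all $\lambda\in[-\pi,\pi]$, $\mathbb E\langle Z_{\lambda_1}-Z_{\lambda_2},Z_{\lambda_3}-Z_{\lambda_4}\rangle_2=0$ whenever $\lambda_1>\lambda_2\ge\lambda_3>\lambda_4$ in $[-\pi,\pi]$, and $T_t=\int_{-\pi}^{\pi}e^{it\lambda}\,dZ_\lambda$ for every $t\in\mathbb Z$. Then a Cramér process of $T$ exists, and for every Cramér process $Z$ of $T$, with $\alpha_{\ell,m}(\lambda)=\langle Z_\lambda,Y_{\ell,m}\rangle_2$: 1. the integrals $\int_{-\pi}^{\pi}e^{it\lambda}\,d\alpha_{\ell,m}(\lambda)$ exist in the sense above and, for every $t\in\mathbb Z$ and every $x\in\mathbb S^2$, $$\mathbb E\Big|T(x,t)-\sum_{\ell=0}^{L}\sum_{m=-\ell}^{\ell}\int_{-\pi}^{\pi}e^{it\lambda}\,d\alpha_{\ell,m}(\lambda)\,Y_{\ell,m}(x)\Big|^2\to0,\qquad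 L\to\infty;$$ 2. for all $\ell,\ell'\ge 0$, $|m|\le\ell$, $|m'|\le\ell'$ and $\omega,\beta\in[-\pi,\pi]$, $$\mathbb E\big[\alpha_{\ell,m}(\omega)\overline{\alpha_{\ell',m'}(\beta)}\big]=\delta_{\ell}^{\ell'}\delta_m^{m'}\int_{-\pi}^{\min(\omega,\beta)}f_\ell(\lambda)\,d\lambda .$$ -/

import Mathlib

open MeasureTheory Filter Topology
open scoped ENNReal ComplexConjugate

/-- Euclidean three-space. -/
abbrev Space3 : Type := EuclideanSpace ℝ (Fin 3)

/-- The unit sphere of Euclidean three-space. -/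
abbrev Sph2 : Type := Metric.sphere (0 : Space3) 1

/-- The surface (area) measure on the unit sphere, of total mass `4π`. -/
noncomputable abbrev sphArea : Measure Sph2 := (volume : Measure Space3).toSphere

/-- The complex Hilbert space of square-integrable functions on the sphere. -/
abbrev SphL2 : Type := Lp ℂ 2 sphArea

/-! ### The trace norm -/

/-- The trace norm `tr |A|`, with `|A| = (A* A)^(1/2)`, as an extended nonnegative real. The trace
of the positive operator `|A|`, that is, `∑ ⟨|A| e, e⟩` over any orthonormal basis, is written
as the supremum of the sums over finite orthonormal sets. -/
noncomputable def traceNorm {E : Type*} [NormedAddCommGroup E] [InnerProductSpace ℂ E]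
    [CompleteSpace E] (A : E →L[ℂ] E) : ℝ≥0∞ :=
  ⨆ (s : Finset E) (_ : Orthonormal ℂ (fun v : s => (v : E))),
    ∑ v ∈ s, ENNReal.ofReal (inner ℂ v (CFC.abs A v)).re

/-! ### Integral operators with continuous kernels -/

theorem sphKernel_bound (k : Sph2 → Sph2 → ℝ) (hk : Continuous fun p : Sph2 × Sph2 => k p.1 p.2) :
    ∃ M : ℝ, 0 ≤ M ∧ ∀ x y, ‖(k x y : ℂ)‖ ≤ M := by
  obtain ⟨M, hM⟩ := isCompact_univ.exists_bound_of_continuousOn hk.continuousOn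
  refine ⟨max M 0, le_max_right _ _, fun x y => ?_⟩
  rw [Complex.norm_real]
  exact (hM (x, y) (Set.mem_univ _)).trans (le_max_left _ _)

theorem sphL2_integrable (h : SphL2) : Integrable (fun y => h y) sphArea :=
  (Lp.memLp h).integrable (by norm_num)

theorem sphKernel_integrable (k : Sph2 → Sph2 → ℝ)
    (hk : Continuous fun p : Sph2 × Sph2 => k p.1 p.2) (h : SphL2) (x : Sph2) :
    Integrable (fun y => (k x y : ℂ) * h y) sphArea := by
  obtain ⟨M, -, hM⟩ := sphKernel_bound k hk
  refine (sphL2_integrable h).bdd_mul (c := M) ?_ (Eventually.of_forall (hM x))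
  have : Continuous fun y => (k x y : ℂ) :=
    Complex.continuous_ofReal.comp (hk.comp (Continuous.prodMk_right x))
  exact this.aestronglyMeasurable

theorem sphL2_l1_le (h : SphL2) :
    ∫ y, ‖h y‖ ∂sphArea ≤ (sphArea Set.univ ^ (1 / 2 : ℝ)).toReal * ‖h‖ := by
  have h1 := eLpNorm_le_eLpNorm_mul_rpow_measure_univ (p := 1) (q := 2) (μ := sphArea)
    (f := fun y => h y) (by norm_num) (Lp.aestronglyMeasurable h)
  rw [integral_norm_eq_lintegral_enorm (Lp.aestronglyMeasurable h), ← eLpNorm_one_eq_lintegral_enorm,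
    Lp.norm_def, ← ENNReal.toReal_mul, mul_comm]
  refine ENNReal.toReal_mono (ENNReal.mul_ne_top (Lp.eLpNorm_ne_top h) ?_) (h1.trans_eq ?_)
  · exact ENNReal.rpow_ne_top_of_nonneg (by norm_num) (measure_ne_top _ _)
  · norm_num

theorem sphKernel_integral_bound (k : Sph2 → Sph2 → ℝ)
    (hk : Continuous fun p : Sph2 × Sph2 => k p.1 p.2) :
    ∃ C : ℝ, 0 ≤ C ∧ ∀ (h : SphL2) (x : Sph2), ‖∫ y, (k x y : ℂ) * h y ∂sphArea‖ ≤ C * ‖h‖ := by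
  obtain ⟨M, hM0, hM⟩ := sphKernel_bound k hk
  refine ⟨M * (sphArea Set.univ ^ (1 / 2 : ℝ)).toReal, by positivity, fun h x => ?_⟩
  calc ‖∫ y, (k x y : ℂ) * h y ∂sphArea‖
      ≤ ∫ y, M * ‖h y‖ ∂sphArea := by
        refine norm_integral_le_of_norm_le ((sphL2_integrable h).norm.const_mul M)
          (Eventually.of_forall fun y => ?_)
        rw [norm_mul]
        exact mul_le_mul_of_nonneg_right (hM x y) (norm_nonneg _)
    _ = M * ∫ y, ‖h y‖ ∂sphArea := integral_const_mul _ _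
    _ ≤ M * ((sphArea Set.univ ^ (1 / 2 : ℝ)).toReal * ‖h‖) :=
        mul_le_mul_of_nonneg_left (sphL2_l1_le h) hM0
    _ = _ := by ring

theorem sphKernel_memLp (k : Sph2 → Sph2 → ℝ)
    (hk : Continuous fun p : Sph2 × Sph2 => k p.1 p.2) (h : SphL2) :
    MemLp (fun x => ∫ y, (k x y : ℂ) * h y ∂sphArea) 2 sphArea := by
  obtain ⟨C, -, hC⟩ := sphKernel_integral_bound k hk
  refine MemLp.of_bound ?_ (C * ‖h‖) (Eventually.of_forall (hC h))
  have h1 : AEStronglyMeasurable (fun p : Sph2 × Sph2 => (k p.1 p.2 : ℂ) * h p.2)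
      (sphArea.prod sphArea) :=
    (Complex.continuous_ofReal.comp hk).aestronglyMeasurable.mul
      (Lp.aestronglyMeasurable h).comp_snd
  exact h1.integral_prod_right'

/-- The operator `(K h)(x) = ∫ k(x,y) h(y) dy` on `L²` of the sphere, for a continuous kernel `k`. -/
noncomputable def kernelOperator (k : Sph2 → Sph2 → ℝ)
    (hk : Continuous fun p : Sph2 × Sph2 => k p.1 p.2) : SphL2 →L[ℂ] SphL2 :=
  LinearMap.mkContinuousOfExistsBound
    { toFun := fun h => (sphKernel_memLp k hk h).toLp (fun x => ∫ y, (k x y : ℂ) * h y ∂sphArea)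
      map_add' := fun h g => by
        rw [← MemLp.toLp_add]
        refine MemLp.toLp_congr _ _ (Eventually.of_forall fun x => ?_)
        rw [Pi.add_apply, ← integral_add (sphKernel_integrable k hk h x)
          (sphKernel_integrable k hk g x)]
        refine integral_congr_ae ?_
        filter_upwards [Lp.coeFn_add h g] with y hy
        rw [hy, Pi.add_apply, mul_add]
      map_smul' := fun c h => by
        rw [RingHom.id_apply, ← MemLp.toLp_const_smul]
        refine MemLp.toLp_congr _ _ (Eventually.of_forall fun x => ?_)
        rw [Pi.smul_apply, ← integral_smul]
        refine integral_congr_ae ?_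
        filter_upwards [Lp.coeFn_smul c h] with y hy
        rw [hy, Pi.smul_apply, smul_eq_mul, smul_eq_mul]
        ring }
    (by
      obtain ⟨C, hC0, hC⟩ := sphKernel_integral_bound k hk
      refine ⟨(measureUnivNNReal sphArea : ℝ) ^ ((2 : ℝ≥0∞).toReal)⁻¹ * C, fun h => ?_⟩
      rw [mul_assoc]
      refine Lp.norm_le_of_ae_bound (by positivity) ?_
      filter_upwards [(sphKernel_memLp k hk h).coeFn_toLp] with x hx
      exact (congrArg norm hx).trans_le (hC h x))

theorem kernelOperator_apply (k : Sph2 → Sph2 → ℝ)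
    (hk : Continuous fun p : Sph2 × Sph2 => k p.1 p.2) (h : SphL2) :
    kernelOperator k hk h =ᵐ[sphArea] fun x => ∫ y, (k x y : ℂ) * h y ∂sphArea :=
  (sphKernel_memLp k hk h).coeFn_toLp

/-! ### Spherical harmonics -/

/-- A spherical harmonic of degree `l`: the restriction to the sphere of a complex homogeneous
polynomial of degree `l` in three variables with vanishing Laplacian. -/
def IsSphericalHarmonic (l : ℕ) (u : Sph2 → ℂ) : Prop :=
  ∃ p : MvPolynomial (Fin 3) ℂ, p.IsHomogeneous l ∧
    ∑ i, MvPolynomial.pderiv i (MvPolynomial.pderiv i p) = 0 ∧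
    ∀ x : Sph2, u x = MvPolynomial.eval (fun i => ((x : Space3) i : ℂ)) p

/-- `Y l m`, for `l ≥ 0` and `-l ≤ m ≤ l`, are orthonormal spherical harmonics, with `2 l + 1` of
them in degree `l`; the values of `Y l m` for other integers `m` are irrelevant. -/
structure IsSphericalHarmonicBasis (Y : ℕ → ℤ → Sph2 → ℂ) : Prop where
  harmonic : ∀ (l : ℕ) (m : ℤ), |m| ≤ l → IsSphericalHarmonic l (Y l m)
  orthonormal : ∀ (l l' : ℕ) (m m' : ℤ), |m| ≤ l → |m'| ≤ l' →
    ∫ x, Y l m x * conj (Y l' m' x) ∂sphArea = if l = l' ∧ m = m' then 1 else 0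

/-! ### Isotropic stationary random fields -/

section Field

variable {Ω : Type*} [MeasurableSpace Ω]

/-- The action of a linear isometry of three-space on the sphere. -/
noncomputable def sphRotate (g : Space3 ≃ₗᵢ[ℝ] Space3) (x : Sph2) : Sph2 :=
  ⟨g x, by simp⟩

/-- A real, zero-mean, isotropic stationary space-time spherical random field with finite second
moments. The rotations are the linear isometries of determinant one. -/
structure IsIsotropicStationary (P : Measure Ω) (T : Sph2 → ℤ → Ω → ℝ) : Prop where
  measurable : ∀ t, Measurable fun p : Sph2 × Ω => T p.1 t p.2
  memLp : ∀ x t, MemLp (T x t) 2 P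
  mean_zero : ∀ x t, ∫ ω, T x t ω ∂P = 0
  invariant : ∀ (x y : Sph2) (g : Space3 ≃ₗᵢ[ℝ] Space3) (t s h : ℤ),
    LinearMap.det (g.toLinearEquiv : Space3 →ₗ[ℝ] Space3) = 1 →
    ∫ ω, T x t ω * T y s ω ∂P =
      ∫ ω, T (sphRotate g x) (t + h) ω * T (sphRotate g y) (s + h) ω ∂P

/-- The autocovariance kernel `r_t(x,y) = E[T(x,t) T(y,0)]`. -/
noncomputable def autocovKernel (P : Measure Ω) (T : Sph2 → ℤ → Ω → ℝ) (t : ℤ) (x y : Sph2) : ℝ :=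
  ∫ ω, T x t ω * T y 0 ω ∂P

open Classical in
/-- The random element `T_t` of `L²` of the sphere given by the field `T(·,t)`; it is set to `0` at
the outcomes (a null set, for the fields considered) whose path is not square integrable. -/
noncomputable def fieldElement (T : Sph2 → ℤ → Ω → ℝ) (t : ℤ) (ω : Ω) : SphL2 :=
  if h : MemLp (fun x => (T x t ω : ℂ)) 2 sphArea then h.toLp (fun x => (T x t ω : ℂ)) else 0

/-- The harmonic coefficient `a_{l,m}(t) = ∫ T(x,t) conj (Y_{l,m}(x)) dx`. -/
noncomputable def harmonicCoeff (Y : ℕ → ℤ → Sph2 → ℂ) (T : Sph2 → ℤ → Ω → ℝ) (l : ℕ) (m t : ℤ)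
    (ω : Ω) : ℂ :=
  ∫ x, (T x t ω : ℂ) * conj (Y l m x) ∂sphArea

/-- `C_l(t) = E[a_{l,m}(t) conj (a_{l,m}(0))]`, which does not depend on `m` for an isotropic
stationary field; the index `m = 0` is used. -/
noncomputable def angularCov (P : Measure Ω) (Y : ℕ → ℤ → Sph2 → ℂ) (T : Sph2 → ℤ → Ω → ℝ) (l : ℕ)
    (t : ℤ) : ℂ :=
  ∫ ω, harmonicCoeff Y T l 0 t ω * conj (harmonicCoeff Y T l 0 0 ω) ∂P

/-- The spectral density `f_l(ν) = (2π)⁻¹ ∑_t e^{-itν} C_l(t)`. -/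
noncomputable def spectralDensity (P : Measure Ω) (Y : ℕ → ℤ → Sph2 → ℂ) (T : Sph2 → ℤ → Ω → ℝ)
    (l : ℕ) (ν : ℝ) : ℂ :=
  (2 * Real.pi : ℂ)⁻¹ * ∑' t : ℤ, Complex.exp (-(Complex.I * t * ν)) * angularCov P Y T l t

/-! ### Mean-square Stieltjes integrals and the Cramér process -/

/-- `I = ∫_{-π}^{π} g(ν) dZ_ν` as a mean-square Riemann–Stieltjes limit: the sums
`∑_j g(u_j) (Z_{u_{j+1}} - Z_{u_j})` over partitions `-π = u_0 < ⋯ < u_J = π` tend to `I` in mean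
square as the mesh of the partition tends to zero. -/
def IsStieltjesIntegral {E : Type*} [NormedAddCommGroup E] [NormedSpace ℂ E] (P : Measure Ω)
    (g : ℝ → ℂ) (Z : ℝ → Ω → E) (I : Ω → E) : Prop :=
  MemLp I 2 P ∧ ∀ ε : ℝ≥0∞, 0 < ε → ∃ δ : ℝ, 0 < δ ∧ ∀ (J : ℕ) (u : ℕ → ℝ),
    u 0 = -Real.pi → u J = Real.pi → (∀ j < J, u j < u (j + 1)) →
    (∀ j < J, u (j + 1) - u j < δ) →
    ∫⁻ ω, ‖I ω - ∑ j ∈ Finset.range J, g (u j) • (Z (u (j + 1)) ω - Z (u j) ω)‖ₑ ^ 2 ∂P < ε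

/-- The character `ν ↦ e^{itν}`. -/
noncomputable def charFn (t : ℤ) (ν : ℝ) : ℂ := Complex.exp (Complex.I * t * ν)

/-- `Z_ν`, `-π ≤ ν ≤ π`, is the process of the Cramér representation of `T`: the `Z_ν` are random
elements of `L²` of the sphere with `E ‖Z_ν‖² = ∑_l (2l+1) ∫_{-π}^{ν} f_l`, their increments are
orthogonal, and `T_t = ∫_{-π}^{π} e^{itν} dZ_ν` for every `t`. These properties determine every
`Z_ν` up to almost sure equality. -/
structure IsCramerProcess (P : Measure Ω) (Y : ℕ → ℤ → Sph2 → ℂ) (T : Sph2 → ℤ → Ω → ℝ)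
    (Z : ℝ → Ω → SphL2) : Prop where
  memLp : ∀ ν ∈ Set.Icc (-Real.pi) Real.pi, MemLp (Z ν) 2 P
  hasSum_norm : ∀ ν ∈ Set.Icc (-Real.pi) Real.pi,
    HasSum (fun l : ℕ => (2 * l + 1 : ℂ) * ∫ θ in (-Real.pi)..ν, spectralDensity P Y T l θ)
      (((∫ ω, ‖Z ν ω‖ ^ 2 ∂P : ℝ)) : ℂ)
  orthogonal : ∀ ν₁ ∈ Set.Icc (-Real.pi) Real.pi, ∀ ν₂ ∈ Set.Icc (-Real.pi) Real.pi,
    ∀ ν₃ ∈ Set.Icc (-Real.pi) Real.pi, ∀ ν₄ ∈ Set.Icc (-Real.pi) Real.pi,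
    ν₂ < ν₁ → ν₃ ≤ ν₂ → ν₄ < ν₃ →
    ∫ ω, inner ℂ (Z ν₃ ω - Z ν₄ ω) (Z ν₁ ω - Z ν₂ ω) ∂P = 0
  representation : ∀ t : ℤ, IsStieltjesIntegral P (charFn t) Z (fieldElement T t)

/-- `α_{l,m}(ν) = ⟨Z_ν, Y_{l,m}⟩ = ∫ Z_ν(x) conj (Y_{l,m}(x)) dx`. -/
noncomputable def incrementCoeff (Y : ℕ → ℤ → Sph2 → ℂ) (Z : ℝ → Ω → SphL2) (l : ℕ) (m : ℤ) (ν : ℝ)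
    (ω : Ω) : ℂ :=
  ∫ x, Z ν ω x * conj (Y l m x) ∂sphArea

end Field

/-!
Write `V_n` for the polynomial functions of degree less than `n` on the sphere. Since
`x₂² = 1 - x₀² - x₁²`, its dimension is at most `∑_{l < n} (2l + 1)`, which is the number of the
harmonics `Y_{l,m}` with `l < n`. Hence these are an orthonormal basis of `V_n`, the harmonics of
degree `l` span the orthogonal complement of `V_l` in `V_{l+1}`, and by Stone–Weierstrass the
`Y_{l,m}` form a Hilbert basis of `L²`. As rotations act transitively on the pairs of points at a
given angle, `r_t` is a zonal kernel, and by the Funk–Hecke formula `Y_{l,m}` is an eigenfunction of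
`R_t`. The eigenvalue is `C_l(t)`, so `E[a_{l,m}(t) conj (a_{l',m'}(s))] = δ δ C_l(t - s)`. The
trace norm dominates the sum of the absolute values of the eigenvalues; therefore
`∑_t ∑_l (2l + 1) |C_l(t)| < ∞`, and `C_l` is the sequence of Fourier coefficients of the bounded
function `f_l`. The mean-square error of the truncated expansion of `T(x, t)` is `r_0(x, x)`
minus a partial sum of `∑_{l,m} C_l(0) |Y_{l,m}(x)|²`; this series has sum `r_0(x, x)`, since the
two do not depend on `x` and their integrals over the sphere agree by Parseval.

The Gram matrix of the `T_t` in `L²(Ω; L²)` is that of the characters `ν ↦ e^{itν}` in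
`L²(-π, π)` with the bounded weight `f = ∑_l (2l + 1) f_l`, so the assignment `e^{itν} ↦ T_t`
extends to a bounded operator `A` on `L²(-π, π)`. The process `Z_ν = A 1_{(-π, ν]}` is a Cramér
process, because `A` maps the Stieltjes sums of the indicators, which converge to `e^{itν}`, to
those of `Z`.

A Cramér process is unique. For any `Z`, orthogonality of the increments determines the norms of
its Stieltjes sums from `ν ↦ ‖Z_ν‖`, so they are the same as for the process above. Over a
partition that contains `ν`, `Z_ν` is itself the Stieltjes sum of `1_{[-π, ν)}`; hence
`‖A f - Z_ν‖ = ‖A f - A 1_{(-π, ν]}‖` for every trigonometric polynomial `f`, and by density for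
`f = 1_{(-π, ν]}`. The covariances of the `α_{l,m}` can therefore be read off from `A`.
-/

/-! ### Rotations -/

section Rotations

variable {F : Type*} [NormedAddCommGroup F] [InnerProductSpace ℝ F]

theorem exists_linearIsometryEquiv_map_pair {x y x' y' : F} (hx : ‖x‖ = ‖x'‖) (hy : ‖y‖ = ‖y'‖)
    (hxy : inner ℝ x y = inner ℝ x' y') : ∃ g : F ≃ₗᵢ[ℝ] F, g x = x' ∧ g y = y' := by
  set g := (ℝ ∙ (x - x'))ᗮ.reflection
  have hgx : g x = x' := Submodule.reflection_sub hx
  set r := (ℝ ∙ (g y - y'))ᗮ.reflection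
  have hry : r (g y) = y' := Submodule.reflection_sub (by rw [g.norm_map, hy])
  have hrx : r x' = x' := by
    refine Submodule.reflection_mem_subspace_eq_self ?_
    rw [Submodule.mem_orthogonal_singleton_iff_inner_right, inner_sub_left, sub_eq_zero,
      real_inner_comm x' y', ← hxy, ← hgx, g.inner_map_map, real_inner_comm]
  exact ⟨g.trans r, by simp [hgx, hrx], by simp [hry]⟩

variable [FiniteDimensional ℝ F]

theorem det_linearIsometryEquiv_eq_one_or_neg_one (g : F ≃ₗᵢ[ℝ] F) :
    LinearMap.det (g.toLinearEquiv : F →ₗ[ℝ] F) = 1 ∨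
      LinearMap.det (g.toLinearEquiv : F →ₗ[ℝ] F) = -1 := by
  obtain ⟨s, -, rfl⟩ := g.reflections_generate_dim
  induction s with
  | nil => exact .inl (LinearMap.det_id)
  | cons v s ih =>
    have hcomp : (((v :: s).map fun v => (ℝ ∙ v)ᗮ.reflection).prod.toLinearEquiv : F →ₗ[ℝ] F) =
        (ℝ ∙ v)ᗮ.reflection.toLinearMap ∘ₗ
          ((s.map fun v => (ℝ ∙ v)ᗮ.reflection).prod.toLinearEquiv : F →ₗ[ℝ] F) := rfl
    rw [hcomp, LinearMap.det_comp, Submodule.det_reflection]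
    rcases neg_one_pow_eq_or ℝ (Module.finrank ℝ (ℝ ∙ v)ᗮᗮ) with h | h <;>
      rcases ih with h' | h' <;> simp [h, h']

theorem exists_ne_zero_inner_eq_zero_pair (hF : 2 < Module.finrank ℝ F) (x y : F) :
    ∃ n : F, n ≠ 0 ∧ inner ℝ n x = 0 ∧ inner ℝ n y = 0 := by
  set S := Submodule.span ℝ (Set.range ![x, y])
  have hS : Sᗮ ≠ ⊥ := by
    rw [Ne, Submodule.orthogonal_eq_bot_iff]
    intro htop
    have hle : Module.finrank ℝ S ≤ Fintype.card (Fin 2) := finrank_range_le_card ![x, y]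
    rw [htop, finrank_top, Fintype.card_fin] at hle
    omega
  obtain ⟨n, hn, hn0⟩ := Submodule.exists_mem_ne_zero_of_ne_bot hS
  rw [Submodule.mem_orthogonal'] at hn
  exact ⟨n, hn0, hn x (Submodule.subset_span ⟨0, rfl⟩), hn y (Submodule.subset_span ⟨1, rfl⟩)⟩

theorem exists_rotation_map_pair (hF : 2 < Module.finrank ℝ F) {x y x' y' : F}
    (hx : ‖x‖ = ‖x'‖) (hy : ‖y‖ = ‖y'‖) (hxy : inner ℝ x y = inner ℝ x' y') :
    ∃ g : F ≃ₗᵢ[ℝ] F, LinearMap.det (g.toLinearEquiv : F →ₗ[ℝ] F) = 1 ∧ g x = x' ∧ g y = y' := by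
  obtain ⟨g, hgx, hgy⟩ := exists_linearIsometryEquiv_map_pair hx hy hxy
  rcases det_linearIsometryEquiv_eq_one_or_neg_one g with hdet | hdet
  · exact ⟨g, hdet, hgx, hgy⟩
  -- The reflection along a vector orthogonal to `x'` and `y'` corrects the determinant.
  obtain ⟨n, hn0, hnx, hny⟩ := exists_ne_zero_inner_eq_zero_pair hF x' y'
  set r := (ℝ ∙ n)ᗮ.reflection with hr
  have hfix : ∀ z, inner ℝ n z = 0 → r z = z := fun z hz =>
    Submodule.reflection_mem_subspace_eq_self
      (Submodule.mem_orthogonal_singleton_iff_inner_right.2 hz)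
  have hcomp : ((g.trans r).toLinearEquiv : F →ₗ[ℝ] F) =
      r.toLinearMap ∘ₗ (g.toLinearEquiv : F →ₗ[ℝ] F) := rfl
  refine ⟨g.trans r, ?_, by simp [hgx, hfix _ hnx], by simp [hgy, hfix _ hny]⟩
  rw [hcomp, LinearMap.det_comp, hdet, hr, Submodule.det_reflection,
    Submodule.orthogonal_orthogonal, finrank_span_singleton hn0]
  norm_num

end Rotations

theorem exists_sphRotate_map_pair {x y x' y' : Sph2}
    (h : inner ℝ (x : Space3) (y : Space3) = inner ℝ (x' : Space3) (y' : Space3)) :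
    ∃ g : Space3 ≃ₗᵢ[ℝ] Space3, LinearMap.det (g.toLinearEquiv : Space3 →ₗ[ℝ] Space3) = 1 ∧
      sphRotate g x = x' ∧ sphRotate g y = y' := by
  obtain ⟨g, hdet, hgx, hgy⟩ := exists_rotation_map_pair (by simp) (by simp) (by simp) h
  exact ⟨g, hdet, Subtype.ext hgx, Subtype.ext hgy⟩

/-- A kernel on the sphere whose value at a pair of points depends on their angle only; this is
invariance under the isometries of the sphere. -/
def IsZonalKernel {α : Type*} (k : Sph2 → Sph2 → α) : Prop :=
  ∀ ⦃x y x' y' : Sph2⦄, inner ℝ (x : Space3) (y : Space3) = inner ℝ (x' : Space3) (y' : Space3) →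
    k x y = k x' y'

namespace IsZonalKernel

variable {α : Type*} {k : Sph2 → Sph2 → α}

theorem of_rotation (h : ∀ (g : Space3 ≃ₗᵢ[ℝ] Space3) (x y : Sph2),
    LinearMap.det (g.toLinearEquiv : Space3 →ₗ[ℝ] Space3) = 1 →
    k (sphRotate g x) (sphRotate g y) = k x y) : IsZonalKernel k := fun x y x' y' hxy => by
  obtain ⟨g, hdet, rfl, rfl⟩ := exists_sphRotate_map_pair hxy
  exact (h g x y hdet).symm

theorem rotate (hk : IsZonalKernel k) (g : Space3 ≃ₗᵢ[ℝ] Space3) (x y : Sph2) :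
    k (sphRotate g x) (sphRotate g y) = k x y := hk (g.inner_map_map _ _)

theorem symm (hk : IsZonalKernel k) (x y : Sph2) : k x y = k y x := hk (real_inner_comm _ _)

theorem diag (hk : IsZonalKernel k) (x y : Sph2) : k x x = k y y := hk (by simp)

end IsZonalKernel

/-- The action of a linear isometry on the sphere, as a homeomorphism. -/
noncomputable def sphRotateHomeomorph (g : Space3 ≃ₗᵢ[ℝ] Space3) : Sph2 ≃ₜ Sph2 where
  toFun := sphRotate g
  invFun := sphRotate g.symm
  left_inv x := Subtype.ext (g.symm_apply_apply x)
  right_inv x := Subtype.ext (g.apply_symm_apply x)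
  continuous_toFun := (g.continuous.comp continuous_subtype_val).subtype_mk _
  continuous_invFun := (g.symm.continuous.comp continuous_subtype_val).subtype_mk _

theorem continuous_sphRotate (g : Space3 ≃ₗᵢ[ℝ] Space3) : Continuous (sphRotate g) :=
  (sphRotateHomeomorph g).continuous

theorem sphRotate_sphRotate_symm (g : Space3 ≃ₗᵢ[ℝ] Space3) (x : Sph2) :
    sphRotate g (sphRotate g.symm x) = x := (sphRotateHomeomorph g).apply_symm_apply x

open scoped Pointwise in
theorem preimage_Ioo_smul_sphere (g : Space3 ≃ₗᵢ[ℝ] Space3) (s : Set Sph2) :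
    g ⁻¹' (Set.Ioo (0 : ℝ) 1 • ((↑) '' s : Set Space3)) =
      Set.Ioo (0 : ℝ) 1 • ((↑) '' (sphRotate g ⁻¹' s) : Set Space3) := by
  ext z
  simp only [Set.mem_smul, Set.mem_image, Set.mem_preimage]
  constructor
  · rintro ⟨r, hr, -, ⟨w, hw, rfl⟩, hz⟩
    refine ⟨r, hr, _, ⟨sphRotate g.symm w, by rwa [sphRotate_sphRotate_symm], rfl⟩, ?_⟩
    apply g.injective
    rw [← hz, map_smul]
    simp [sphRotate]
  · rintro ⟨r, hr, -, ⟨w, hw, rfl⟩, rfl⟩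
    exact ⟨r, hr, _, ⟨_, hw, rfl⟩, by simp [sphRotate]⟩

theorem measurePreserving_sphRotate (g : Space3 ≃ₗᵢ[ℝ] Space3) :
    MeasurePreserving (sphRotate g) sphArea sphArea := by
  refine ⟨(continuous_sphRotate g).measurable, Measure.ext fun s hs => ?_⟩
  have hgs := (continuous_sphRotate g).measurable hs
  rw [Measure.map_apply (continuous_sphRotate g).measurable hs, Measure.toSphere_apply' _ hs,
    Measure.toSphere_apply' _ hgs, ← preimage_Ioo_smul_sphere,
    g.measurePreserving.measure_preimage_emb g.toHomeomorph.measurableEmbedding]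

theorem integral_sphRotate {E : Type*} [NormedAddCommGroup E] [NormedSpace ℝ E]
    (g : Space3 ≃ₗᵢ[ℝ] Space3) (f : Sph2 → E) :
    ∫ x, f (sphRotate g x) ∂sphArea = ∫ x, f x ∂sphArea :=
  (measurePreserving_sphRotate g).integral_comp (sphRotateHomeomorph g).measurableEmbedding f

theorem sphArea_real_univ_pos : 0 < sphArea.real Set.univ :=
  ENNReal.toReal_pos ((Measure.measure_univ_pos).2 (Measure.toSphere_ne_zero _)).ne'
    (measure_ne_top _ _)

theorem integrable_of_continuous_of_compactSpace {X E : Type*} [TopologicalSpace X]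
    [CompactSpace X] [MeasurableSpace X] [OpensMeasurableSpace X] {μ : Measure X}
    [IsFiniteMeasureOnCompacts μ] [NormedAddCommGroup E] {f : X → E} (hf : Continuous f) :
    Integrable f μ :=
  hf.integrable_of_hasCompactSupport (HasCompactSupport.of_compactSpace f)

/-! ### Polynomial functions on the sphere -/

/-- The coordinate functions, as complex-valued functions on the sphere. -/
noncomputable def sphCoord (i : Fin 3) : C(Sph2, ℂ) where
  toFun x := ((x : Space3) i : ℂ)

/-- The monomial functions on the sphere. -/
noncomputable def sphMonomial (d : Fin 3 → ℕ) : C(Sph2, ℂ) := ∏ i, sphCoord i ^ d i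

/-- The space of polynomial functions of degree less than `n` on the sphere; the bound is strict, as
in `Polynomial.degreeLT`. -/
noncomputable def sphDegreeLT (n : ℕ) : Submodule ℂ C(Sph2, ℂ) :=
  Submodule.span ℂ (sphMonomial '' {d | ∑ i, d i < n})

theorem sphCoord_apply (i : Fin 3) (x : Sph2) : sphCoord i x = ((x : Space3) i : ℂ) := rfl

theorem sphMonomial_apply (d : Fin 3 → ℕ) (x : Sph2) :
    sphMonomial d x = ∏ i, ((x : Space3) i : ℂ) ^ d i := by
  simp [sphMonomial, sphCoord_apply]

theorem sphMonomial_single (i : Fin 3) : sphMonomial (Pi.single i 1) = sphCoord i := by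
  rw [sphMonomial, Finset.prod_eq_single i] <;> simp +contextual

theorem sphMonomial_zero : sphMonomial 0 = 1 := by simp [sphMonomial]

theorem sphMonomial_mul (d e : Fin 3 → ℕ) :
    sphMonomial d * sphMonomial e = sphMonomial (d + e) := by
  simp only [sphMonomial, ← Finset.prod_mul_distrib, Pi.add_apply, pow_add]

theorem star_sphMonomial (d : Fin 3 → ℕ) : star (sphMonomial d) = sphMonomial d := by
  ext x
  simp [sphMonomial_apply]

theorem sum_sq_sphCoord : ∑ i, sphCoord i ^ 2 = 1 := by
  ext x
  have h : ‖(x : Space3)‖ ^ 2 = 1 := by simp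
  rw [EuclideanSpace.norm_sq_eq] at h
  simp only [Real.norm_eq_abs, sq_abs] at h
  simp only [ContinuousMap.coe_sum, Finset.sum_apply, ContinuousMap.pow_apply, sphCoord_apply,
    ContinuousMap.one_apply]
  exact_mod_cast h

theorem sphMonomial_mem_sphDegreeLT {n : ℕ} {d : Fin 3 → ℕ} (h : ∑ i, d i < n) :
    sphMonomial d ∈ sphDegreeLT n := Submodule.subset_span ⟨d, h, rfl⟩

theorem sphDegreeLT_le {n : ℕ} {S : Submodule ℂ C(Sph2, ℂ)}
    (h : ∀ d, ∑ i, d i < n → sphMonomial d ∈ S) : sphDegreeLT n ≤ S :=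
  Submodule.span_le.2 (Set.image_subset_iff.2 h)

theorem sphDegreeLT_mono : Monotone sphDegreeLT := fun _ _ h =>
  sphDegreeLT_le fun _ hd => sphMonomial_mem_sphDegreeLT (hd.trans_le h)

theorem one_mem_sphDegreeLT : 1 ∈ sphDegreeLT 1 :=
  sphMonomial_zero ▸ sphMonomial_mem_sphDegreeLT (by simp)

theorem sphCoord_mem_sphDegreeLT (i : Fin 3) : sphCoord i ∈ sphDegreeLT 2 :=
  sphMonomial_single i ▸ sphMonomial_mem_sphDegreeLT (by simp)

theorem mul_mem_sphDegreeLT {n m : ℕ} {f g : C(Sph2, ℂ)} (hf : f ∈ sphDegreeLT (n + 1))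
    (hg : g ∈ sphDegreeLT (m + 1)) : f * g ∈ sphDegreeLT (n + m + 1) := by
  have hle : sphDegreeLT (n + 1) * sphDegreeLT (m + 1) ≤ sphDegreeLT (n + m + 1) := by
    rw [sphDegreeLT, sphDegreeLT, Submodule.span_mul_span, Submodule.span_le]
    rintro _ ⟨_, ⟨d, hd : ∑ i, d i < n + 1, rfl⟩, _, ⟨e, he : ∑ i, e i < m + 1, rfl⟩, rfl⟩
    simp only [sphMonomial_mul]
    refine sphMonomial_mem_sphDegreeLT ?_
    simp only [Pi.add_apply, Finset.sum_add_distrib]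
    omega
  exact hle (Submodule.mul_mem_mul hf hg)

theorem pow_mem_sphDegreeLT {f : C(Sph2, ℂ)} (hf : f ∈ sphDegreeLT 2) (k : ℕ) :
    f ^ k ∈ sphDegreeLT (k + 1) := by
  induction k with
  | zero => simpa using one_mem_sphDegreeLT
  | succ k ih => rw [pow_succ]; exact mul_mem_sphDegreeLT ih hf

theorem prod_pow_mem_sphDegreeLT {f : Fin 3 → C(Sph2, ℂ)} (hf : ∀ i, f i ∈ sphDegreeLT 2)
    (d : Fin 3 → ℕ) : ∏ i, f i ^ d i ∈ sphDegreeLT (∑ i, d i + 1) := by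
  rw [Fin.prod_univ_three, Fin.sum_univ_three]
  exact mul_mem_sphDegreeLT (mul_mem_sphDegreeLT (pow_mem_sphDegreeLT (hf 0) _)
    (pow_mem_sphDegreeLT (hf 1) _)) (pow_mem_sphDegreeLT (hf 2) _)

theorem star_mem_sphDegreeLT {n : ℕ} {f : C(Sph2, ℂ)} (hf : f ∈ sphDegreeLT n) :
    star f ∈ sphDegreeLT n := by
  induction hf using Submodule.span_induction with
  | mem _ hf =>
    obtain ⟨d, hd, rfl⟩ := hf
    rw [star_sphMonomial]
    exact sphMonomial_mem_sphDegreeLT hd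
  | zero => rw [star_zero]; exact Submodule.zero_mem _
  | add f g _ _ hf hg => rw [star_add]; exact Submodule.add_mem _ hf hg
  | smul c f _ hf => rw [star_smul]; exact Submodule.smul_mem _ _ hf

/-- Composition with a linear isometry, on the functions on the sphere. -/
noncomputable def sphPullback (g : Space3 ≃ₗᵢ[ℝ] Space3) : C(Sph2, ℂ) →ₐ[ℂ] C(Sph2, ℂ) :=
  ContinuousMap.compRightAlgHom ℂ ℂ (sphRotateHomeomorph g : C(Sph2, Sph2))

theorem sphPullback_apply (g : Space3 ≃ₗᵢ[ℝ] Space3) (f : C(Sph2, ℂ)) (x : Sph2) :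
    sphPullback g f x = f (sphRotate g x) := rfl

theorem sphPullback_sphPullback_symm (g : Space3 ≃ₗᵢ[ℝ] Space3) (f : C(Sph2, ℂ)) :
    sphPullback g (sphPullback g.symm f) = f := by
  ext x
  exact congrArg f (Subtype.ext (g.symm_apply_apply x))

theorem sphPullback_sphCoord (g : Space3 ≃ₗᵢ[ℝ] Space3) (i : Fin 3) :
    sphPullback g (sphCoord i) =
      ∑ j, ((g (EuclideanSpace.single j 1) i : ℝ) : ℂ) • sphCoord j := by
  ext x
  have hx : (x : Space3) = ∑ j, (x : Space3) j • EuclideanSpace.single j (1 : ℝ) := by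
    simpa using ((EuclideanSpace.basisFun (Fin 3) ℝ).sum_repr (x : Space3)).symm
  have hgx : g x = ∑ j, (x : Space3) j • g (EuclideanSpace.single j (1 : ℝ)) := by
    conv_lhs => rw [hx]
    simp only [map_sum, map_smul]
  simp only [sphPullback_apply, sphCoord_apply, sphRotate, hgx, ContinuousMap.add_apply,
    ContinuousMap.smul_apply, smul_eq_mul, Fin.sum_univ_three, PiLp.add_apply, PiLp.smul_apply]
  push_cast
  ring

theorem sphPullback_mem_sphDegreeLT (g : Space3 ≃ₗᵢ[ℝ] Space3) {n : ℕ} {f : C(Sph2, ℂ)}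
    (hf : f ∈ sphDegreeLT n) : sphPullback g f ∈ sphDegreeLT n := by
  have hcoord (i : Fin 3) : sphPullback g (sphCoord i) ∈ sphDegreeLT 2 := by
    rw [sphPullback_sphCoord]
    exact Submodule.sum_mem _ fun j _ => Submodule.smul_mem _ _ (sphCoord_mem_sphDegreeLT j)
  have hle : sphDegreeLT n ≤ (sphDegreeLT n).comap (sphPullback g).toLinearMap :=
    sphDegreeLT_le fun d hd => by
      simp only [Submodule.mem_comap, AlgHom.toLinearMap_apply, sphMonomial, map_prod, map_pow]
      exact sphDegreeLT_mono hd (prod_pow_mem_sphDegreeLT hcoord d)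
  exact hle hf

theorem IsSphericalHarmonic.exists_mem_sphDegreeLT {l : ℕ} {u : Sph2 → ℂ}
    (hu : IsSphericalHarmonic l u) : ∃ f ∈ sphDegreeLT (l + 1), ⇑f = u := by
  obtain ⟨p, hp, -, hup⟩ := hu
  refine ⟨∑ d ∈ p.support, p.coeff d • sphMonomial d, ?_, ?_⟩
  · refine Submodule.sum_mem _ fun d hd =>
      Submodule.smul_mem _ _ (sphMonomial_mem_sphDegreeLT ?_)
    have hdeg := hp (MvPolynomial.mem_support_iff.1 hd)
    rw [Finsupp.weight_apply, Finsupp.sum_fintype _ _ (by simp)] at hdeg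
    simp only [Pi.one_apply, smul_eq_mul, mul_one] at hdeg
    omega
  · ext x
    rw [hup, MvPolynomial.eval_eq']
    simp [sphMonomial_apply]

/-! ### The dimension of the space of polynomial functions -/

/-- The monomials of degree less than `n` that are of degree at most one in the last variable, the
others being reducible by `x₂ ^ 2 = 1 - x₀ ^ 2 - x₁ ^ 2`; in degree `l` there are `l + 1` of them
without `x₂` and `l` with `x₂`. -/
noncomputable def reducedMonomial (n : ℕ) : (Σ l : Fin n, Fin (l + 1) ⊕ Fin l) → C(Sph2, ℂ)
  | ⟨l, .inl a⟩ => sphMonomial ![a, l - a, 0]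
  | ⟨l, .inr a⟩ => sphMonomial ![a, l - 1 - a, 1]

theorem sphMonomial_add_two (a b c : ℕ) : sphMonomial ![a, b, c + 2] =
    sphMonomial ![a, b, c] - sphMonomial ![a + 2, b, c] - sphMonomial ![a, b + 2, c] := by
  have h := sum_sq_sphCoord
  simp only [sphMonomial, Fin.prod_univ_three, Fin.sum_univ_three] at h ⊢
  simp only [Matrix.cons_val]
  linear_combination sphCoord 0 ^ a * sphCoord 1 ^ b * sphCoord 2 ^ c * h

theorem sphMonomial_mem_span_reducedMonomial {n : ℕ} : ∀ c a b : ℕ, a + b + c < n →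
    sphMonomial ![a, b, c] ∈ Submodule.span ℂ (Set.range (reducedMonomial n))
  | 0, a, b, h => by
    refine Submodule.subset_span ⟨⟨⟨a + b, by omega⟩, .inl ⟨a, by simp⟩⟩, ?_⟩
    simp [reducedMonomial]
  | 1, a, b, h => by
    refine Submodule.subset_span ⟨⟨⟨a + b + 1, by omega⟩, .inr ⟨a, by simp⟩⟩, ?_⟩
    simp [reducedMonomial]
  | c + 2, a, b, h => by
    rw [sphMonomial_add_two]
    exact Submodule.sub_mem _ (Submodule.sub_mem _
      (sphMonomial_mem_span_reducedMonomial c a b (by omega))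
      (sphMonomial_mem_span_reducedMonomial c (a + 2) b (by omega)))
      (sphMonomial_mem_span_reducedMonomial c a (b + 2) (by omega))

theorem sphDegreeLT_le_span_reducedMonomial (n : ℕ) :
    sphDegreeLT n ≤ Submodule.span ℂ (Set.range (reducedMonomial n)) :=
  sphDegreeLT_le fun d hd => by
    rw [Fin.sum_univ_three] at hd
    convert sphMonomial_mem_span_reducedMonomial _ _ _ hd
    ext i
    fin_cases i <;> rfl

instance finiteDimensional_sphDegreeLT (n : ℕ) : FiniteDimensional ℂ (sphDegreeLT n) := by
  have := FiniteDimensional.span_of_finite ℂ (Set.finite_range (reducedMonomial n))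
  exact Submodule.finiteDimensional_of_le (sphDegreeLT_le_span_reducedMonomial n)

theorem finrank_sphDegreeLT_le (n : ℕ) :
    Module.finrank ℂ (sphDegreeLT n) ≤ ∑ l ∈ Finset.range n, (2 * l + 1) := by
  have := FiniteDimensional.span_of_finite ℂ (Set.finite_range (reducedMonomial n))
  calc Module.finrank ℂ (sphDegreeLT n)
      ≤ Module.finrank ℂ (Submodule.span ℂ (Set.range (reducedMonomial n))) :=
        Submodule.finrank_mono (sphDegreeLT_le_span_reducedMonomial n)
    _ ≤ Fintype.card (Σ l : Fin n, Fin (l + 1) ⊕ Fin l) := finrank_range_le_card _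
    _ = ∑ l ∈ Finset.range n, (2 * l + 1) := by
        simp only [Fintype.card_sigma, Fintype.card_sum, Fintype.card_fin]
        rw [Finset.sum_range]
        exact Finset.sum_congr rfl fun l _ => by ring

/-! ### Zonal polynomial functions -/

/-- The point at angle `θ` from the north pole on the great circle in the plane `x₁ = 0`. -/
noncomputable def sphMeridian (θ : ℝ) : Sph2 :=
  ⟨!₂[Real.sin θ, 0, Real.cos θ], by simp [EuclideanSpace.norm_eq, Fin.sum_univ_three]⟩

/-- The north pole. -/
noncomputable def northPole : Sph2 := ⟨EuclideanSpace.single 2 1, by simp⟩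

/-- A function on the sphere that depends on the last coordinate only. -/
def IsZonal (f : Sph2 → ℂ) : Prop := ∀ ⦃x y : Sph2⦄, (x : Space3) 2 = (y : Space3) 2 → f x = f y

theorem inner_northPole (x : Sph2) :
    inner ℝ (x : Space3) (northPole : Space3) = (x : Space3) 2 := by
  simp [northPole, EuclideanSpace.inner_single_right]

theorem IsZonalKernel.isZonal {k : Sph2 → Sph2 → ℂ} (hk : IsZonalKernel k) :
    IsZonal fun x => k x northPole := fun x y h =>
  hk (by rw [inner_northPole, inner_northPole, h])

theorem sphMeridian_arccos (x : Sph2) :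
    (sphMeridian (Real.arccos ((x : Space3) 2)) : Space3) 2 = (x : Space3) 2 := by
  have h := (PiLp.norm_apply_le (x : Space3) 2).trans_eq (norm_eq_of_mem_sphere x)
  rw [Real.norm_eq_abs, abs_le] at h
  simp [sphMeridian, Real.cos_arccos h.1 h.2]

theorem exists_polynomial_sphMonomial_sphMeridian {n : ℕ} {d : Fin 3 → ℕ} (hd : ∑ i, d i < n) :
    ∃ q ∈ Polynomial.degreeLT ℂ n, ∀ θ : ℝ, sphMonomial d (sphMeridian θ) +
      sphMonomial d (sphMeridian (-θ)) = 2 * q.eval (Real.cos θ : ℂ) := by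
  rw [Fin.sum_univ_three] at hd
  rcases eq_or_ne (d 1) 0 with h1 | h1
  swap
  · exact ⟨0, Submodule.zero_mem _, fun θ => by
      simp [sphMonomial_apply, Fin.prod_univ_three, sphMeridian, h1]⟩
  rcases Nat.even_or_odd' (d 0) with ⟨k, hk | hk⟩
  · refine ⟨(1 - Polynomial.X ^ 2) ^ k * Polynomial.X ^ d 2, ?_, fun θ => ?_⟩
    · rw [Polynomial.mem_degreeLT]
      refine (Polynomial.degree_le_of_natDegree_le (n := 2 * k + d 2) ?_).trans_lt
        (by exact_mod_cast (show 2 * k + d 2 < n by omega))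
      compute_degree
      simp [mul_comm]
    · simp [sphMonomial_apply, Fin.prod_univ_three, sphMeridian, h1, hk, pow_mul, Complex.sin_sq]
      ring
  · refine ⟨0, Submodule.zero_mem _, fun θ => ?_⟩
    simp [sphMonomial_apply, Fin.prod_univ_three, sphMeridian, h1, hk, pow_succ, pow_mul]

theorem exists_polynomial_sphMeridian {n : ℕ} {f : C(Sph2, ℂ)} (hf : f ∈ sphDegreeLT n) :
    ∃ q ∈ Polynomial.degreeLT ℂ n, ∀ θ : ℝ,
      f (sphMeridian θ) + f (sphMeridian (-θ)) = 2 * q.eval (Real.cos θ : ℂ) := by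
  induction hf using Submodule.span_induction with
  | mem _ hf =>
    obtain ⟨d, hd, rfl⟩ := hf
    exact exists_polynomial_sphMonomial_sphMeridian hd
  | zero => exact ⟨0, Submodule.zero_mem _, by simp⟩
  | add f g _ _ hf hg =>
    obtain ⟨p, hp, hfp⟩ := hf
    obtain ⟨q, hq, hgq⟩ := hg
    refine ⟨p + q, Submodule.add_mem _ hp hq, fun θ => ?_⟩
    simp only [ContinuousMap.add_apply, Polynomial.eval_add]
    linear_combination hfp θ + hgq θ
  | smul c f _ hf =>
    obtain ⟨p, hp, hfp⟩ := hf
    refine ⟨c • p, Submodule.smul_mem _ _ hp, fun θ => ?_⟩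
    simp only [ContinuousMap.smul_apply, smul_eq_mul, Polynomial.eval_smul]
    linear_combination c * hfp θ

theorem aeval_mem_sphDegreeLT {n : ℕ} {q : Polynomial ℂ} (hq : q ∈ Polynomial.degreeLT ℂ n)
    {f : C(Sph2, ℂ)} (hf : f ∈ sphDegreeLT 2) : Polynomial.aeval f q ∈ sphDegreeLT n := by
  rw [Polynomial.aeval_def, Polynomial.eval₂_eq_sum, Polynomial.sum]
  refine Submodule.sum_mem _ fun i hi => ?_
  rw [← Algebra.smul_def]
  refine Submodule.smul_mem _ _ (sphDegreeLT_mono ?_ (pow_mem_sphDegreeLT hf i))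
  rw [Polynomial.mem_degreeLT] at hq
  exact_mod_cast (Polynomial.le_degree_of_mem_supp i hi).trans_lt hq

theorem IsZonal.exists_polynomial {n : ℕ} {f : C(Sph2, ℂ)} (hz : IsZonal f)
    (hf : f ∈ sphDegreeLT n) :
    ∃ q ∈ Polynomial.degreeLT ℂ n, Polynomial.aeval (sphCoord 2) q = f := by
  obtain ⟨q, hq, hfq⟩ := exists_polynomial_sphMeridian hf
  refine ⟨q, hq, ContinuousMap.ext fun x => ?_⟩
  set θ := Real.arccos ((x : Space3) 2)
  have hθ : Real.cos θ = (x : Space3) 2 := by simpa [sphMeridian] using sphMeridian_arccos x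
  have h := hfq θ
  rw [hz (show (sphMeridian θ : Space3) 2 = (x : Space3) 2 by simp [sphMeridian, hθ]),
    hz (show (sphMeridian (-θ) : Space3) 2 = (x : Space3) 2 by simp [sphMeridian, hθ]), hθ,
    ← two_mul] at h
  have heval : Polynomial.aeval (sphCoord 2) q x = q.eval (sphCoord 2 x) := by
    rw [← ContinuousMap.evalAlgHom_apply ℂ ℂ x, ← Polynomial.aeval_algHom_apply]
    rfl
  rw [heval, sphCoord_apply, mul_left_cancel₀ two_ne_zero h]

theorem exists_sub_smul_mem_degreeLT {K : Type*} [Field K] {l : ℕ} {p q : Polynomial K}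
    (hp : p ∈ Polynomial.degreeLT K (l + 1)) (hq : q ∈ Polynomial.degreeLT K (l + 1))
    (hql : q ∉ Polynomial.degreeLT K l) : ∃ c : K, p - c • q ∈ Polynomial.degreeLT K l := by
  have hdrop {r : Polynomial K} (hr : r ∈ Polynomial.degreeLT K (l + 1)) (h0 : r.coeff l = 0) :
      r ∈ Polynomial.degreeLT K l := by
    rw [Polynomial.mem_degreeLT, Polynomial.degree_lt_iff_coeff_zero] at *
    intro m hm
    rcases hm.eq_or_lt with rfl | hm
    · exact h0
    · exact hr m hm
  have hq0 : q.coeff l ≠ 0 := fun h => hql (hdrop hq h)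
  refine ⟨p.coeff l / q.coeff l, hdrop (Submodule.sub_mem _ hp (Submodule.smul_mem _ _ hq)) ?_⟩
  rw [Polynomial.coeff_sub, Polynomial.coeff_smul, smul_eq_mul, div_mul_cancel₀ _ hq0, sub_self]

/-! ### Spaces of spherical harmonics -/

/-- The continuous functions on the sphere as square-integrable functions. -/
noncomputable abbrev sphToL2 : C(Sph2, ℂ) →L[ℂ] SphL2 := ContinuousMap.toLp 2 sphArea ℂ

theorem coeFn_sphToL2 (f : C(Sph2, ℂ)) : sphToL2 f =ᵐ[sphArea] f :=
  ContinuousMap.coeFn_toLp sphArea f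

theorem inner_sphToL2_left (f : C(Sph2, ℂ)) (h : SphL2) :
    inner ℂ (sphToL2 f) h = ∫ x, h x * conj (f x) ∂sphArea := by
  rw [L2.inner_def]
  refine integral_congr_ae ?_
  filter_upwards [coeFn_sphToL2 f] with x hx
  rw [hx, RCLike.inner_apply]

theorem inner_sphToL2 (f g : C(Sph2, ℂ)) :
    inner ℂ (sphToL2 f) (sphToL2 g) = ∫ x, g x * conj (f x) ∂sphArea :=
  ContinuousMap.inner_toLp sphArea f g

theorem inner_sphToL2_star (f g : C(Sph2, ℂ)) :
    inner ℂ (sphToL2 f) (sphToL2 (star g)) = inner ℂ (sphToL2 g) (sphToL2 (star f)) := by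
  simp only [inner_sphToL2, ContinuousMap.star_apply, RCLike.star_def, mul_comm]

theorem inner_sphToL2_sphPullback (g : Space3 ≃ₗᵢ[ℝ] Space3) (f h : C(Sph2, ℂ)) :
    inner ℂ (sphToL2 (sphPullback g f)) (sphToL2 h) =
      inner ℂ (sphToL2 f) (sphToL2 (sphPullback g.symm h)) := by
  conv_lhs => rw [← sphPullback_sphPullback_symm g h]
  rw [inner_sphToL2, inner_sphToL2]
  exact integral_sphRotate g fun x => sphPullback g.symm h x * conj (f x)

theorem sphToL2_injective : Function.Injective sphToL2 :=
  ContinuousMap.toLp_injective sphArea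

theorem eq_zero_of_inner_sphToL2_self {f : C(Sph2, ℂ)}
    (h : inner ℂ (sphToL2 f) (sphToL2 f) = 0) : f = 0 :=
  sphToL2_injective ((inner_self_eq_zero.1 h).trans (map_zero _).symm)

/-- The polynomial functions of degree at most `l` on the sphere that are orthogonal to the
polynomial functions of degree less than `l`. -/
noncomputable def harmSpace (l : ℕ) : Submodule ℂ C(Sph2, ℂ) :=
  sphDegreeLT (l + 1) ⊓ ((sphDegreeLT l).map sphToL2.toLinearMap)ᗮ.comap sphToL2.toLinearMap

theorem mem_harmSpace {l : ℕ} {f : C(Sph2, ℂ)} : f ∈ harmSpace l ↔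
    f ∈ sphDegreeLT (l + 1) ∧ ∀ h ∈ sphDegreeLT l, inner ℂ (sphToL2 h) (sphToL2 f) = 0 := by
  simp [harmSpace, Submodule.mem_orthogonal]

theorem star_mem_harmSpace {l : ℕ} {f : C(Sph2, ℂ)} (hf : f ∈ harmSpace l) :
    star f ∈ harmSpace l := by
  rw [mem_harmSpace] at hf ⊢
  refine ⟨star_mem_sphDegreeLT hf.1, fun h hh => ?_⟩
  rw [inner_sphToL2_star, ← inner_conj_symm, hf.2 _ (star_mem_sphDegreeLT hh), map_zero]

theorem sphPullback_mem_harmSpace (g : Space3 ≃ₗᵢ[ℝ] Space3) {l : ℕ} {f : C(Sph2, ℂ)}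
    (hf : f ∈ harmSpace l) : sphPullback g f ∈ harmSpace l := by
  rw [mem_harmSpace] at hf ⊢
  refine ⟨sphPullback_mem_sphDegreeLT g hf.1, fun h hh => ?_⟩
  rw [← inner_conj_symm, inner_sphToL2_sphPullback, inner_conj_symm,
    hf.2 _ (sphPullback_mem_sphDegreeLT _ hh)]

theorem eq_zero_of_mem_harmSpace_of_mem_sphDegreeLT {l : ℕ} {f : C(Sph2, ℂ)}
    (hf : f ∈ harmSpace l) (hf' : f ∈ sphDegreeLT l) : f = 0 :=
  eq_zero_of_inner_sphToL2_self ((mem_harmSpace.1 hf).2 f hf')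

theorem exists_mem_harmSpace_inner_eq (l : ℕ) (g : SphL2) : ∃ h ∈ harmSpace l,
    ∀ f ∈ harmSpace l, inner ℂ (sphToL2 h) (sphToL2 f) = inner ℂ g (sphToL2 f) := by
  have : FiniteDimensional ℂ (harmSpace l) := Submodule.finiteDimensional_of_le inf_le_left
  set V := (harmSpace l).map sphToL2.toLinearMap
  obtain ⟨h, hh, hproj⟩ := Submodule.mem_map.1 (V.starProjection_apply_mem g)
  refine ⟨h, hh, fun f hf => ?_⟩
  have hfV : V.starProjection (sphToL2 f) = sphToL2 f :=
    Submodule.starProjection_eq_self_iff.2 ⟨f, hf, rfl⟩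
  calc inner ℂ (sphToL2 h) (sphToL2 f) = inner ℂ (V.starProjection g) (sphToL2 f) :=
        congrArg (fun v : SphL2 => inner ℂ v (sphToL2 f)) hproj
    _ = inner ℂ g (sphToL2 f) := by
        rw [Submodule.inner_starProjection_left_eq_right, hfV]

theorem IsZonal.exists_smul_eq {l : ℕ} {f g : C(Sph2, ℂ)} (hf : f ∈ harmSpace l)
    (hg : g ∈ harmSpace l) (hfz : IsZonal f) (hgz : IsZonal g) (hg0 : g ≠ 0) :
    ∃ c : ℂ, f = c • g := by
  obtain ⟨p, hp, hfp⟩ := hfz.exists_polynomial (mem_harmSpace.1 hf).1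
  obtain ⟨q, hq, hgq⟩ := hgz.exists_polynomial (mem_harmSpace.1 hg).1
  have hql : q ∉ Polynomial.degreeLT ℂ l := fun hql => hg0 <|
    eq_zero_of_mem_harmSpace_of_mem_sphDegreeLT hg
      (hgq ▸ aeval_mem_sphDegreeLT hql (sphCoord_mem_sphDegreeLT 2))
  obtain ⟨c, hc⟩ := exists_sub_smul_mem_degreeLT hp hq hql
  refine ⟨c, sub_eq_zero.1 (eq_zero_of_mem_harmSpace_of_mem_sphDegreeLT
    (Submodule.sub_mem _ hf (Submodule.smul_mem _ c hg)) ?_)⟩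
  have h := aeval_mem_sphDegreeLT hc (sphCoord_mem_sphDegreeLT 2)
  rwa [map_sub, map_smul, hfp, hgq] at h

/-! ### The basis of spherical harmonics -/

/-- The pairs `(l, m)` with `-l ≤ m ≤ l`. -/
abbrev HarmIndex : Type := Σ l : ℕ, Finset.Icc (-(l : ℤ)) (l : ℤ)

namespace HarmIndex

theorem abs_le (i : HarmIndex) : |(i.2 : ℤ)| ≤ (i.1 : ℕ) := _root_.abs_le.2 (Finset.mem_Icc.1 i.2.2)

/-- The index `(l, m)`. -/
def mk {l : ℕ} {m : ℤ} (hm : |m| ≤ l) : HarmIndex := ⟨l, m, Finset.mem_Icc.2 (_root_.abs_le.1 hm)⟩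

theorem ext_iff {i j : HarmIndex} : i = j ↔ i.1 = j.1 ∧ (i.2 : ℤ) = j.2 := by
  obtain ⟨l, m, hm⟩ := i
  obtain ⟨l', m', hm'⟩ := j
  constructor
  · rintro ⟨⟩
    exact ⟨rfl, rfl⟩
  · rintro ⟨rfl : l = l', rfl : m = m'⟩
    rfl

theorem hasSum_fst {G : Type*} [AddCommMonoid G] [TopologicalSpace G] [ContinuousAdd G]
    [RegularSpace G] {g : ℕ → G} {a : G} (h : HasSum (fun i : HarmIndex => g i.1) a) :
    HasSum (fun l : ℕ => (2 * l + 1) • g l) a :=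
  h.sigma fun l => by
    convert hasSum_fintype fun _ : Finset.Icc (-(l : ℤ)) (l : ℤ) => g l using 1
    rw [Finset.sum_const, Finset.card_univ, Fintype.card_coe, Int.card_Icc]
    congr 1
    omega

end HarmIndex

theorem exists_mem_sphDegreeLT_of_mem_adjoin {f : C(Sph2, ℂ)}
    (hf : f ∈ StarAlgebra.adjoin ℂ (Set.range sphCoord)) : ∃ n, f ∈ sphDegreeLT (n + 1) := by
  induction hf using StarAlgebra.adjoin_induction with
  | mem f hf =>
    obtain ⟨i, rfl⟩ := hf
    exact ⟨1, sphCoord_mem_sphDegreeLT i⟩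
  | algebraMap r =>
    rw [Algebra.algebraMap_eq_smul_one]
    exact ⟨0, Submodule.smul_mem _ r one_mem_sphDegreeLT⟩
  | add f g _ _ hf hg =>
    obtain ⟨n, hn⟩ := hf
    obtain ⟨m, hm⟩ := hg
    exact ⟨n + m, Submodule.add_mem _ (sphDegreeLT_mono (by omega) hn)
      (sphDegreeLT_mono (by omega) hm)⟩
  | mul f g _ _ hf hg =>
    obtain ⟨n, hn⟩ := hf
    obtain ⟨m, hm⟩ := hg
    exact ⟨n + m, mul_mem_sphDegreeLT hn hm⟩
  | star f _ hf =>
    obtain ⟨n, hn⟩ := hf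
    exact ⟨n, star_mem_sphDegreeLT hn⟩

theorem dense_adjoin_sphCoord :
    Dense (StarAlgebra.adjoin ℂ (Set.range sphCoord) : Set C(Sph2, ℂ)) := by
  have hsep : (StarAlgebra.adjoin ℂ (Set.range sphCoord)).SeparatesPoints := fun x y hxy => by
    obtain ⟨i, hi⟩ : ∃ i, (x : Space3) i ≠ (y : Space3) i := by
      by_contra! h
      exact hxy (Subtype.ext (PiLp.ext h))
    refine ⟨_, ⟨sphCoord i, StarAlgebra.subset_adjoin ℂ _ ⟨i, rfl⟩, rfl⟩, ?_⟩
    simpa [sphCoord_apply] using hi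
  have h := ContinuousMap.starSubalgebra_topologicalClosure_eq_top_of_separatesPoints _ hsep
  rw [dense_iff_closure_eq, ← StarSubalgebra.topologicalClosure_coe, h]
  rfl

namespace IsSphericalHarmonicBasis

variable {Y : ℕ → ℤ → Sph2 → ℂ} (hY : IsSphericalHarmonicBasis Y)

include hY in
theorem exists_mem_sphDegreeLT (i : HarmIndex) : ∃ f ∈ sphDegreeLT (i.1 + 1), ⇑f = Y i.1 i.2 :=
  (hY.harmonic i.1 i.2 i.abs_le).exists_mem_sphDegreeLT

include hY in
protected theorem continuous {l : ℕ} {m : ℤ} (hm : |m| ≤ l) : Continuous (Y l m) := by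
  obtain ⟨f, -, hf⟩ := hY.exists_mem_sphDegreeLT (.mk hm)
  exact hf ▸ f.continuous

/-- The spherical harmonics as continuous maps. -/
noncomputable def harmonicMap (i : HarmIndex) : C(Sph2, ℂ) := ⟨Y i.1 i.2, hY.continuous i.abs_le⟩

/-- The spherical harmonics as elements of `L²`. -/
noncomputable def toL2 (i : HarmIndex) : SphL2 := sphToL2 (hY.harmonicMap i)

theorem coeFn_toL2 (i : HarmIndex) : hY.toL2 i =ᵐ[sphArea] Y i.1 i.2 :=
  coeFn_sphToL2 (hY.harmonicMap i)

theorem inner_toL2 (i : HarmIndex) (h : SphL2) :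
    inner ℂ (hY.toL2 i) h = ∫ x, h x * conj (Y i.1 i.2 x) ∂sphArea := inner_sphToL2_left _ h

theorem harmonicMap_mem_sphDegreeLT (i : HarmIndex) : hY.harmonicMap i ∈ sphDegreeLT (i.1 + 1) := by
  obtain ⟨f, hf, hfY⟩ := hY.exists_mem_sphDegreeLT i
  rwa [show hY.harmonicMap i = f from DFunLike.coe_injective hfY.symm]

theorem orthonormal_toL2 : Orthonormal ℂ hY.toL2 := by
  rw [orthonormal_iff_ite]
  intro i j
  rw [toL2, toL2, inner_sphToL2]
  simp only [harmonicMap, ContinuousMap.coe_mk, hY.orthonormal _ _ _ _ j.abs_le i.abs_le,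
    HarmIndex.ext_iff, eq_comm]

theorem linearIndependent_harmonicMap : LinearIndependent ℂ hY.harmonicMap :=
  LinearIndependent.of_comp sphToL2.toLinearMap hY.orthonormal_toL2.linearIndependent

-- The `∑ (2 l + 1)` harmonics of degree less than `n` are as many as the dimension allows; this
-- replaces Green's formula in the proof that they are orthogonal to polynomials of lower degree.
theorem span_harmonicMap (n : ℕ) :
    Submodule.span ℂ (hY.harmonicMap '' {i | i.1 < n}) = sphDegreeLT n := by
  set S : Finset HarmIndex := (Finset.range n).sigma fun _ => Finset.univ
  have hS : (S : Set HarmIndex) = {i | i.1 < n} := by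
    ext i
    simp [S]
  have hli : LinearIndependent ℂ fun i : S => hY.harmonicMap i :=
    hY.linearIndependent_harmonicMap.comp _ Subtype.val_injective
  have hspan : Set.range (fun i : S => hY.harmonicMap i) = hY.harmonicMap '' {i | i.1 < n} := by
    rw [← hS, Set.image_eq_range]
    rfl
  refine Submodule.eq_of_le_of_finrank_le (Submodule.span_le.2 ?_) ?_
  · rintro _ ⟨i, hi, rfl⟩
    exact sphDegreeLT_mono hi (hY.harmonicMap_mem_sphDegreeLT i)
  · rw [← hspan, finrank_span_eq_card hli, Fintype.card_coe, Finset.card_sigma]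
    refine (finrank_sphDegreeLT_le n).trans_eq (Finset.sum_congr rfl fun l _ => ?_)
    rw [Finset.card_univ, Fintype.card_coe, Int.card_Icc]
    omega

theorem inner_sphToL2_eq_zero {n : ℕ} {v : SphL2} (h : ∀ i, i.1 < n → inner ℂ (hY.toL2 i) v = 0)
    {f : C(Sph2, ℂ)} (hf : f ∈ sphDegreeLT n) : inner ℂ (sphToL2 f) v = 0 := by
  rw [← hY.span_harmonicMap n] at hf
  induction hf using Submodule.span_induction with
  | mem _ hf =>
    obtain ⟨i, hi, rfl⟩ := hf
    exact h i hi
  | zero => rw [map_zero, inner_zero_left]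
  | add f g _ _ hf hg => rw [map_add, inner_add_left, hf, hg, add_zero]
  | smul c f _ hf => rw [map_smul, inner_smul_left, hf, mul_zero]

theorem harmonicMap_mem_harmSpace (i : HarmIndex) : hY.harmonicMap i ∈ harmSpace i.1 :=
  mem_harmSpace.2 ⟨hY.harmonicMap_mem_sphDegreeLT i, fun _ hh =>
    hY.inner_sphToL2_eq_zero (fun _ hj => hY.orthonormal_toL2.2 fun h => hj.ne (h ▸ rfl)) hh⟩

theorem eq_sum_of_mem_harmSpace {l : ℕ} {f : C(Sph2, ℂ)} (hf : f ∈ harmSpace l) :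
    f = ∑ m : Finset.Icc (-(l : ℤ)) l,
      inner ℂ (hY.toL2 ⟨l, m⟩) (sphToL2 f) • hY.harmonicMap ⟨l, m⟩ := by
  set s := ∑ m : Finset.Icc (-(l : ℤ)) l,
    inner ℂ (hY.toL2 ⟨l, m⟩) (sphToL2 f) • hY.harmonicMap ⟨l, m⟩
  have hs : s ∈ harmSpace l := Submodule.sum_mem _ fun m _ =>
    Submodule.smul_mem _ _ (hY.harmonicMap_mem_harmSpace ⟨l, m⟩)
  have hfs : f - s ∈ harmSpace l := Submodule.sub_mem _ hf hs
  refine sub_eq_zero.1 (eq_zero_of_inner_sphToL2_self (hY.inner_sphToL2_eq_zero (n := l + 1) ?_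
    (mem_harmSpace.1 hfs).1))
  rintro ⟨l', m'⟩ (hl' : l' < l + 1)
  rcases Nat.lt_succ_iff_lt_or_eq.1 hl' with hlt | rfl
  · exact (mem_harmSpace.1 hfs).2 _
      (sphDegreeLT_mono hlt (hY.harmonicMap_mem_sphDegreeLT ⟨l', m'⟩))
  · have hon : Orthonormal ℂ fun m : Finset.Icc (-(l' : ℤ)) l' => hY.toL2 ⟨l', m⟩ :=
      hY.orthonormal_toL2.comp _ sigma_mk_injective
    have hs' : sphToL2 s = ∑ m : Finset.Icc (-(l' : ℤ)) l',
        inner ℂ (hY.toL2 ⟨l', m⟩) (sphToL2 f) • hY.toL2 ⟨l', m⟩ := by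
      simp only [s, map_sum, map_smul, toL2]
    rw [map_sub, inner_sub_right, hs', hon.inner_right_fintype, sub_self]

theorem topologicalClosure_span_toL2 :
    (Submodule.span ℂ (Set.range hY.toL2)).topologicalClosure = ⊤ := by
  rw [Submodule.topologicalClosure_eq_top_iff, Submodule.eq_bot_iff]
  intro v hv
  have hvY (i : HarmIndex) : inner ℂ (hY.toL2 i) v = 0 :=
    (Submodule.mem_orthogonal _ _).1 hv _ (Submodule.subset_span ⟨i, rfl⟩)
  have hclosed : IsClosed {w : SphL2 | inner ℂ w v = 0} :=
    isClosed_eq (by fun_prop) continuous_const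
  have hadj : ∀ f ∈ StarAlgebra.adjoin ℂ (Set.range sphCoord), inner ℂ (sphToL2 f) v = 0 :=
    fun f hf => by
      obtain ⟨n, hn⟩ := exists_mem_sphDegreeLT_of_mem_adjoin hf
      exact hY.inner_sphToL2_eq_zero (fun i _ => hvY i) hn
  have hcont (f : C(Sph2, ℂ)) : inner ℂ (sphToL2 f) v = 0 :=
    (hclosed.preimage sphToL2.continuous).closure_subset_iff.2 hadj (dense_adjoin_sphCoord f)
  have hdense : DenseRange sphToL2 := ContinuousMap.toLp_denseRange ℂ sphArea ℂ (by norm_num)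
  exact inner_self_eq_zero.1 (hdense.induction_on (p := fun w => inner ℂ w v = 0) v hclosed hcont)

/-- The spherical harmonics as a Hilbert basis of `L²`. -/
noncomputable def hilbertBasis : HilbertBasis HarmIndex ℂ SphL2 :=
  HilbertBasis.mk hY.orthonormal_toL2 hY.topologicalClosure_span_toL2.ge

theorem hilbertBasis_apply (i : HarmIndex) : hY.hilbertBasis i = hY.toL2 i :=
  congrFun (HilbertBasis.coe_mk _ _) i

/-! ### Zonal harmonics -/

/-- The zonal harmonic of degree `l` and pole `y`, as the reproducing kernel
`∑ m, conj (Y l m y) • Y l m` of the spherical harmonics of degree `l`. -/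
noncomputable def zonalHarmonic (l : ℕ) (y : Sph2) : C(Sph2, ℂ) :=
  ∑ m : Finset.Icc (-(l : ℤ)) l, conj (Y l m y) • hY.harmonicMap ⟨l, m⟩

theorem zonalHarmonic_apply (l : ℕ) (x y : Sph2) : hY.zonalHarmonic l y x =
    ∑ m : Finset.Icc (-(l : ℤ)) l, Y l m x * conj (Y l m y) := by
  simp [zonalHarmonic, harmonicMap, mul_comm]

theorem conj_zonalHarmonic_apply (l : ℕ) (x y : Sph2) :
    conj (hY.zonalHarmonic l y x) = hY.zonalHarmonic l x y := by
  simp [zonalHarmonic_apply, mul_comm]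

theorem zonalHarmonic_mem_harmSpace (l : ℕ) (y : Sph2) : hY.zonalHarmonic l y ∈ harmSpace l :=
  Submodule.sum_mem _ fun m _ => Submodule.smul_mem _ _ (hY.harmonicMap_mem_harmSpace ⟨l, m⟩)

theorem inner_zonalHarmonic {l : ℕ} {f : C(Sph2, ℂ)} (hf : f ∈ harmSpace l) (y : Sph2) :
    inner ℂ (sphToL2 (hY.zonalHarmonic l y)) (sphToL2 f) = f y := by
  conv_rhs => rw [hY.eq_sum_of_mem_harmSpace hf]
  simp only [zonalHarmonic, map_sum, map_smul, sum_inner, inner_smul_left, Complex.conj_conj,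
    ContinuousMap.coe_sum, Finset.sum_apply, ContinuousMap.smul_apply, smul_eq_mul, toL2]
  exact Finset.sum_congr rfl fun m _ => mul_comm _ _

theorem isZonalKernel_zonalHarmonic (l : ℕ) :
    IsZonalKernel fun x y => hY.zonalHarmonic l y x := by
  refine IsZonalKernel.of_rotation fun g x y _ => ?_
  have hpull := sphPullback_mem_harmSpace g (hY.zonalHarmonic_mem_harmSpace l (sphRotate g y))
  have hpull' := sphPullback_mem_harmSpace g.symm (hY.zonalHarmonic_mem_harmSpace l x)
  calc hY.zonalHarmonic l (sphRotate g y) (sphRotate g x)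
      = inner ℂ (sphToL2 (hY.zonalHarmonic l x))
          (sphToL2 (sphPullback g (hY.zonalHarmonic l (sphRotate g y)))) :=
        (hY.inner_zonalHarmonic hpull x).symm
    _ = conj (inner ℂ (sphToL2 (hY.zonalHarmonic l (sphRotate g y)))
          (sphToL2 (sphPullback g.symm (hY.zonalHarmonic l x)))) := by
        rw [← inner_sphToL2_sphPullback, inner_conj_symm]
    _ = conj (hY.zonalHarmonic l x (sphRotate g.symm (sphRotate g y))) := by
        rw [hY.inner_zonalHarmonic hpull', sphPullback_apply]
    _ = hY.zonalHarmonic l y x := by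
        rw [show sphRotate g.symm (sphRotate g y) = y from
          (sphRotateHomeomorph g).symm_apply_apply y, hY.conj_zonalHarmonic_apply]

theorem sphArea_mul_zonalHarmonic_self (l : ℕ) (x : Sph2) :
    (sphArea.real Set.univ : ℂ) * hY.zonalHarmonic l x x = 2 * l + 1 := by
  calc (sphArea.real Set.univ : ℂ) * hY.zonalHarmonic l x x
      = ∫ y, hY.zonalHarmonic l y y ∂sphArea := by
        rw [integral_congr_ae (Eventually.of_forall fun y =>
          (hY.isZonalKernel_zonalHarmonic l).diag y x), integral_const, Complex.real_smul]
    _ = ∑ m : Finset.Icc (-(l : ℤ)) l, ∫ y, Y l m y * conj (Y l m y) ∂sphArea := by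
        simp only [zonalHarmonic_apply]
        refine integral_finsetSum _ fun m _ => integrable_of_continuous_of_compactSpace ?_
        have hc := hY.continuous (HarmIndex.abs_le ⟨l, m⟩)
        exact hc.mul (Complex.continuous_conj.comp hc)
    _ = ∑ _m : Finset.Icc (-(l : ℤ)) l, 1 := Finset.sum_congr rfl fun m _ => by
        rw [hY.orthonormal _ _ _ _ (HarmIndex.abs_le ⟨l, m⟩) (HarmIndex.abs_le ⟨l, m⟩), if_pos]
        exact ⟨rfl, rfl⟩
    _ = 2 * l + 1 := by
        rw [Finset.sum_const, Finset.card_univ, Fintype.card_coe, Int.card_Icc, nsmul_one,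
          show ((l : ℤ) + 1 - -l).toNat = 2 * l + 1 by omega]
        push_cast
        rfl

theorem zonalHarmonic_ne_zero (l : ℕ) (y : Sph2) : hY.zonalHarmonic l y ≠ 0 := fun h0 => by
  have h := hY.sphArea_mul_zonalHarmonic_self l y
  rw [h0, ContinuousMap.zero_apply, mul_zero] at h
  exact (2 * l).cast_add_one_ne_zero (R := ℂ) (by push_cast; exact h.symm)

theorem exists_eq_mul_zonalHarmonic {l : ℕ} {q : Sph2 → Sph2 → ℂ} (hq : IsZonalKernel q)
    {f : C(Sph2, ℂ)} (hf : f ∈ harmSpace l) (hqf : ∀ x, q x northPole = f x) :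
    ∃ c : ℂ, ∀ x y, q x y = c * hY.zonalHarmonic l y x := by
  have hZ := hY.isZonalKernel_zonalHarmonic l
  have hfz : IsZonal f := fun x y hxy => by
    simpa only [hqf] using hq.isZonal hxy
  obtain ⟨c, rfl⟩ := IsZonal.exists_smul_eq hf (hY.zonalHarmonic_mem_harmSpace l northPole) hfz
    hZ.isZonal (hY.zonalHarmonic_ne_zero l northPole)
  refine ⟨c, fun x y => ?_⟩
  obtain ⟨g, -, hg, -⟩ := exists_sphRotate_map_pair (show inner ℝ (y : Space3) (y : Space3) =
    inner ℝ (northPole : Space3) (northPole : Space3) by simp)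
  rw [← hq.rotate g, ← hZ.rotate g, hg]
  exact hqf _

include hY in
/-- **Funk–Hecke formula**. -/
theorem exists_integral_zonalKernel_eq {k : Sph2 → Sph2 → ℂ} (hk : ∀ x, Continuous (k x))
    (hz : IsZonalKernel k) (l : ℕ) :
    ∃ c : ℂ, ∀ f ∈ harmSpace l, ∀ x, ∫ u, k x u * f u ∂sphArea = c * f x := by
  have hrepr (x : Sph2) : ∃ h ∈ harmSpace l, ∀ f ∈ harmSpace l,
      inner ℂ (sphToL2 h) (sphToL2 f) = ∫ u, k x u * f u ∂sphArea := by
    obtain ⟨h, hh, hhk⟩ := exists_mem_harmSpace_inner_eq l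
      (sphToL2 (star (⟨k x, hk x⟩ : C(Sph2, ℂ))))
    refine ⟨h, hh, fun f hf => ?_⟩
    rw [hhk f hf, inner_sphToL2]
    simp [mul_comm]
  choose h hh hhk using hrepr
  -- The kernel `K Z` is zonal and lies in `harmSpace l` as a function of either variable.
  set q : Sph2 → Sph2 → ℂ := fun x y => ∫ u, k x u * hY.zonalHarmonic l y u ∂sphArea
  have hqh (x y : Sph2) : q x y = conj (h x y) := by
    simp only [q]
    rw [← hhk x _ (hY.zonalHarmonic_mem_harmSpace l y), ← hY.inner_zonalHarmonic (hh x),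
      inner_conj_symm]
  have hqz : IsZonalKernel q := IsZonalKernel.of_rotation fun g x y _ => by
    simp only [q]
    rw [← integral_sphRotate g]
    simp only [hz.rotate, (hY.isZonalKernel_zonalHarmonic l).rotate g]
  obtain ⟨c, hc⟩ := hY.exists_eq_mul_zonalHarmonic hqz (star_mem_harmSpace (hh northPole))
    fun x => (hqz.symm x northPole).trans (hqh northPole x)
  have hhc (x : Sph2) : h x = conj c • hY.zonalHarmonic l x := by
    ext y
    rw [← Complex.conj_conj (h x y), ← hqh, hc, map_mul, hY.conj_zonalHarmonic_apply]
    rfl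
  refine ⟨c, fun f hf x => ?_⟩
  rw [← hhk x f hf, hhc, map_smul, inner_smul_left, Complex.conj_conj, hY.inner_zonalHarmonic hf]

end IsSphericalHarmonicBasis

/-! ### A lower bound for the trace norm -/

section TraceNorm

variable {E : Type*} [NormedAddCommGroup E] [InnerProductSpace ℂ E]

open ContinuousLinearMap in
theorem apply_eq_smul_of_apply_apply_eq_sq_smul {B : E →L[ℂ] E} (hB : B.IsPositive) {r : ℝ}
    (hr : 0 ≤ r) {v : E} (h : B (B v) = ((r : ℂ) ^ 2) • v) : B v = (r : ℂ) • v := by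
  rcases hr.eq_or_lt with rfl | hr
  · have h0 : inner ℂ (B v) (B v) = 0 := by
      rw [hB.isSymmetric.apply_clm, h]
      simp
    simpa using inner_self_eq_zero.1 h0
  set w := B v - (r : ℂ) • v with hw
  have hBw : B w = -((r : ℂ) • w) := by
    rw [hw, map_sub, map_smul, h, smul_sub, smul_smul, sq]
    abel
  have hneg : 0 ≤ -(r * ‖w‖ ^ 2) := by
    have hpos := hB.re_inner_nonneg_left w
    rw [hBw, inner_neg_left, inner_smul_left, inner_self_eq_norm_sq_to_K, Complex.conj_ofReal]
      at hpos
    rwa [← Complex.ofReal_re (-(r * ‖w‖ ^ 2)), Complex.ofReal_neg, Complex.ofReal_mul,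
      Complex.ofReal_pow]
  have hw0 : ‖w‖ ^ 2 = 0 := by nlinarith [sq_nonneg ‖w‖]
  exact sub_eq_zero.1 (norm_eq_zero.1 (pow_eq_zero_iff two_ne_zero |>.1 hw0))

variable [CompleteSpace E]

theorem cfcAbs_apply_of_eigenvector {A : E →L[ℂ] E} {v : E} {c : ℂ} (h : A v = c • v)
    (h' : ContinuousLinearMap.adjoint A v = conj c • v) : CFC.abs A v = (‖c‖ : ℂ) • v := by
  refine apply_eq_smul_of_apply_apply_eq_sq_smul
    ((ContinuousLinearMap.nonneg_iff_isPositive _).1 (CFC.abs_nonneg A)) (norm_nonneg c) ?_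
  calc CFC.abs A (CFC.abs A v)
      = ContinuousLinearMap.adjoint A (A v) := congrArg (fun S => S v) (CFC.abs_mul_abs A)
    _ = ((‖c‖ : ℂ) ^ 2) • v := by rw [h, map_smul, h', smul_smul, Complex.mul_conj']

theorem adjoint_apply_of_eigenbasis {ι : Type*} (b : HilbertBasis ι ℂ E) {A : E →L[ℂ] E}
    {c : ι → ℂ} (h : ∀ i, A (b i) = c i • b i) (i : ι) :
    ContinuousLinearMap.adjoint A (b i) = conj (c i) • b i := by
  classical
  refine b.repr.injective (lp.ext (funext fun j => ?_))
  rw [b.repr_apply_apply, b.repr_apply_apply, ContinuousLinearMap.adjoint_inner_right, h,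
    inner_smul_left, inner_smul_right, orthonormal_iff_ite.1 b.orthonormal]
  split_ifs with hij
  · rw [hij]
  · simp

theorem sum_inner_abs_le_traceNorm {ι : Type*} {v : ι → E} (hv : Orthonormal ℂ v) (A : E →L[ℂ] E)
    (s : Finset ι) :
    ∑ i ∈ s, ENNReal.ofReal (inner ℂ (v i) (CFC.abs A (v i))).re ≤ traceNorm A := by
  classical
  have hinj := hv.linearIndependent.injective
  have hs : Orthonormal ℂ fun u : s.image v => (u : E) := by
    refine hv.toSubtypeRange.comp (Set.inclusion fun u hu => ?_) (Set.inclusion_injective _)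
    obtain ⟨i, -, rfl⟩ := Finset.mem_image.1 hu
    exact ⟨i, rfl⟩
  rw [← Finset.sum_image (f := fun u => ENNReal.ofReal (inner ℂ u (CFC.abs A u)).re) hinj.injOn]
  exact le_iSup₂ (f := fun (s : Finset E) (_ : Orthonormal ℂ fun u : s => (u : E)) =>
    ∑ u ∈ s, ENNReal.ofReal (inner ℂ u (CFC.abs A u)).re) (s.image v) hs

theorem tsum_norm_eigenvalue_le_traceNorm {ι : Type*} (b : HilbertBasis ι ℂ E) {A : E →L[ℂ] E}
    {c : ι → ℂ} (h : ∀ i, A (b i) = c i • b i) :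
    ∑' i, ENNReal.ofReal ‖c i‖ ≤ traceNorm A := by
  rw [ENNReal.tsum_eq_iSup_sum]
  refine iSup_le fun s => le_trans (le_of_eq ?_) (sum_inner_abs_le_traceNorm b.orthonormal A s)
  refine Finset.sum_congr rfl fun i _ => ?_
  rw [cfcAbs_apply_of_eigenvector (h i) (adjoint_apply_of_eigenbasis b h i), inner_smul_right,
    inner_self_eq_norm_sq_to_K, b.orthonormal.1 i]
  simp

end TraceNorm

theorem IsSphericalHarmonicBasis.tsum_norm_eigenvalue_le_traceNorm {Y : ℕ → ℤ → Sph2 → ℂ}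
    (hY : IsSphericalHarmonicBasis Y) {k : Sph2 → Sph2 → ℝ}
    (hk : Continuous fun p : Sph2 × Sph2 => k p.1 p.2) {c : HarmIndex → ℂ}
    (h : ∀ i x, ∫ y, (k x y : ℂ) * Y i.1 i.2 y ∂sphArea = c i * Y i.1 i.2 x) :
    ∑' i, ENNReal.ofReal ‖c i‖ ≤ traceNorm (kernelOperator k hk) := by
  refine _root_.tsum_norm_eigenvalue_le_traceNorm hY.hilbertBasis fun i => ?_
  rw [hY.hilbertBasis_apply]
  refine Lp.ext ?_
  filter_upwards [kernelOperator_apply k hk (hY.toL2 i), Lp.coeFn_smul (c i) (hY.toL2 i),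
    hY.coeFn_toL2 i] with x hK hc hx
  rw [hK, hc, Pi.smul_apply, hx, smul_eq_mul, ← h]
  refine integral_congr_ae ?_
  filter_upwards [hY.coeFn_toL2 i] with y hy
  rw [hy]

/-! ### Square-integrable random elements of a Hilbert space -/

section RandomElement

variable {Ω : Type*} [MeasurableSpace Ω] {P : Measure Ω}

theorem enorm_sq_eq_lintegral {E : Type*} [NormedAddCommGroup E] (F : Lp E 2 P) :
    ‖F‖ₑ ^ 2 = ∫⁻ ω, ‖F ω‖ₑ ^ 2 ∂P := by
  have h := eLpNorm_nnreal_pow_eq_lintegral (f := F) (μ := P) (p := 2) two_ne_zero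
  rw [Lp.enorm_def]
  simpa using h

theorem coeFn_sum_smul {E ι : Type*} [NormedAddCommGroup E] [NormedSpace ℂ E] (s : Finset ι)
    (z : ι → ℂ) {f : ι → Lp E 2 P} {g : ι → Ω → E} (h : ∀ i ∈ s, f i =ᵐ[P] g i) :
    (∑ i ∈ s, z i • f i : Lp E 2 P) =ᵐ[P] fun ω => ∑ i ∈ s, z i • g i ω := by
  have hsmul : ∀ i ∈ s, ∀ᵐ ω ∂P, (z i • f i : Lp E 2 P) ω = z i • g i ω := fun i hi => by
    filter_upwards [Lp.coeFn_smul (z i) (f i), h i hi] with ω hz hg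
    rw [hz, Pi.smul_apply, hg]
  filter_upwards [Lp.coeFn_fun_finsetSum s fun i => z i • f i,
    (ae_ball_iff s.countable_toSet).2 hsmul] with ω hsum hω
  rw [hsum]
  exact Finset.sum_congr rfl hω

variable {E : Type*} [NormedAddCommGroup E] [InnerProductSpace ℂ E]

theorem norm_sq_eq_integral (F : Lp E 2 P) : ‖F‖ ^ 2 = ∫ ω, ‖F ω‖ ^ 2 ∂P := by
  have h := L2.inner_def (𝕜 := ℂ) F F
  simp_rw [inner_self_eq_norm_sq_to_K] at h
  rw [← Complex.ofReal_inj, ← integral_complex_ofReal]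
  simpa using h

/-- The map `F ↦ ⟨e, F⟩` on square-integrable random elements. -/
noncomputable def innerLp (P : Measure Ω) (e : E) : Lp E 2 P →L[ℂ] Lp ℂ 2 P :=
  (innerSL ℂ e).compLpL 2 P

theorem coeFn_innerLp (e : E) (F : Lp E 2 P) : innerLp P e F =ᵐ[P] fun ω => inner ℂ e (F ω) :=
  (innerSL ℂ e).coeFn_compLp F

theorem hasSum_norm_inner_sq {ι : Type*} (b : HilbertBasis ι ℂ E) (x : E) :
    HasSum (fun i => ‖inner ℂ (b i) x‖ ^ 2) (‖x‖ ^ 2) := by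
  rw [← Complex.hasSum_ofReal]
  have h := b.hasSum_inner_mul_inner x x
  simp_rw [inner_self_eq_norm_sq_to_K, ← inner_conj_symm x (b _), Complex.conj_mul'] at h
  simp only [Complex.ofReal_pow]
  exact h

theorem hasSum_inner_innerLp {ι : Type*} [Countable ι] (b : HilbertBasis ι ℂ E)
    (F G : Lp E 2 P) :
    HasSum (fun i => inner ℂ (innerLp P (b i) F) (innerLp P (b i) G)) (inner ℂ F G) := by
  have hi : ∀ i, inner ℂ (innerLp P (b i) F) (innerLp P (b i) G) =
      ∫ ω, inner ℂ (F ω) (b i) * inner ℂ (b i) (G ω) ∂P := fun i => by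
    rw [L2.inner_def]
    refine integral_congr_ae ?_
    filter_upwards [coeFn_innerLp (b i) F, coeFn_innerLp (b i) G] with ω hF hG
    rw [hF, hG, RCLike.inner_apply, inner_conj_symm, mul_comm]
  simp_rw [hi]
  rw [L2.inner_def]
  have hint : ∀ F : Lp E 2 P, Integrable (fun ω => ‖F ω‖ ^ 2) P := fun F =>
    (Lp.memLp F).integrable_norm_pow (p := 2) two_ne_zero
  have hbound : ∀ ω, HasSum (fun i => ‖inner ℂ (b i) (F ω)‖ ^ 2 + ‖inner ℂ (b i) (G ω)‖ ^ 2)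
      (‖F ω‖ ^ 2 + ‖G ω‖ ^ 2) := fun ω =>
    (hasSum_norm_inner_sq b (F ω)).add (hasSum_norm_inner_sq b (G ω))
  refine hasSum_integral_of_dominated_convergence
    (fun i ω => ‖inner ℂ (b i) (F ω)‖ ^ 2 + ‖inner ℂ (b i) (G ω)‖ ^ 2) (fun i => ?_)
    (fun i => Eventually.of_forall fun ω => ?_) (Eventually.of_forall fun ω => (hbound ω).summable)
    ?_ (Eventually.of_forall fun ω => b.hasSum_inner_mul_inner _ _)
  · exact ((Lp.aestronglyMeasurable F).inner aestronglyMeasurable_const).mul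
      (aestronglyMeasurable_const.inner (Lp.aestronglyMeasurable G))
  · rw [norm_mul, norm_inner_symm (F ω)]
    nlinarith [sq_nonneg (‖inner ℂ (b i) (F ω)‖ - ‖inner ℂ (b i) (G ω)‖),
      sq_nonneg ‖inner ℂ (b i) (F ω)‖, sq_nonneg ‖inner ℂ (b i) (G ω)‖]
  · simp_rw [fun ω => (hbound ω).tsum_eq]
    exact (hint F).add (hint G)

theorem inner_sub_sum_self_of_orthogonal {ι : Type*} (s : Finset ι) {v : ι → E} {w : E}
    {z : ι → ℂ} (hv : ∀ i ∈ s, ∀ j ∈ s, i ≠ j → inner ℂ (v i) (v j) = 0)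
    (hw : ∀ i ∈ s, inner ℂ (v i) w = z i * inner ℂ (v i) (v i)) :
    inner ℂ (w - ∑ i ∈ s, z i • v i) (w - ∑ i ∈ s, z i • v i) =
      inner ℂ w w - ∑ i ∈ s, z i * conj (z i) * inner ℂ (v i) (v i) := by
  set S := ∑ i ∈ s, z i • v i with hS
  have hvS : ∀ i ∈ s, inner ℂ (v i) (w - S) = 0 := fun i hi => by
    rw [inner_sub_right, hw i hi, hS, inner_sum, Finset.sum_eq_single_of_mem i hi, inner_smul_right,
      sub_self]
    exact fun j hj hji => by rw [inner_smul_right, hv i hi j hj hji.symm, mul_zero]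
  have hSw : inner ℂ S (w - S) = 0 := by
    rw [hS, sum_inner]
    exact Finset.sum_eq_zero fun i hi => by rw [inner_smul_left, hvS i hi, mul_zero]
  have hwS : inner ℂ w S = ∑ i ∈ s, z i * conj (z i) * inner ℂ (v i) (v i) := by
    rw [hS, inner_sum]
    refine Finset.sum_congr rfl fun i hi => ?_
    rw [inner_smul_right, ← inner_conj_symm, hw i hi, map_mul, inner_conj_symm, mul_assoc]
  rw [inner_sub_left, hSw, sub_zero, inner_sub_right, hwS]

end RandomElement

/-! ### Second-order structure of isotropic stationary fields -/

theorem HarmIndex.sum_sigma_univ {M : Type*} [AddCommMonoid M] (s : Finset ℕ) (f : ℕ → ℤ → M) :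
    ∑ i ∈ s.sigma fun l => (Finset.univ : Finset (Finset.Icc (-(l : ℤ)) l)), f i.1 i.2 =
      ∑ l ∈ s, ∑ m ∈ Finset.Icc (-(l : ℤ)) l, f l m := by
  rw [Finset.sum_sigma]
  exact Finset.sum_congr rfl fun l _ => Finset.sum_coe_sort (Finset.Icc (-(l : ℤ)) l) (f l)

namespace IsIsotropicStationary

variable {Ω : Type*} [MeasurableSpace Ω] {P : Measure Ω} {T : Sph2 → ℤ → Ω → ℝ}
  {Y : ℕ → ℤ → Sph2 → ℂ}

section Covariance

variable (hT : IsIsotropicStationary P T)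

include hT

theorem integral_mul (x y : Sph2) (t s : ℤ) :
    ∫ ω, T x t ω * T y s ω ∂P = autocovKernel P T (t - s) x y := by
  have h := hT.invariant x y (LinearIsometryEquiv.refl ℝ Space3) t s (-s) LinearMap.det_id
  rwa [add_neg_cancel] at h

theorem isZonalKernel (t : ℤ) : IsZonalKernel (autocovKernel P T t) :=
  .of_rotation fun g x y hg => by
    have h := hT.invariant x y g t 0 0 hg
    rw [add_zero, add_zero] at h
    exact h.symm

theorem integral_sq (x y : Sph2) (t : ℤ) : ∫ ω, T x t ω ^ 2 ∂P = autocovKernel P T 0 y y := by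
  rw [← (hT.isZonalKernel 0).diag x y, ← sub_self t, ← hT.integral_mul]
  simp only [sq]

theorem stronglyMeasurable_harmonicCoeff (hY : IsSphericalHarmonicBasis Y) (i : HarmIndex) (t : ℤ) :
    StronglyMeasurable (harmonicCoeff Y T i.1 i.2 t) := by
  have hm : StronglyMeasurable fun p : Sph2 × Ω => (T p.1 t p.2 : ℂ) * conj (Y i.1 i.2 p.1) :=
    ((Complex.measurable_ofReal.comp (hT.measurable t)).mul
      ((Complex.continuous_conj.comp (hY.continuous i.abs_le)).measurable.comp
        measurable_fst)).stronglyMeasurable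
  exact hm.integral_prod_left'

/-- The random variable `T(x, t)` as an element of `L²(Ω)`. -/
noncomputable def pointL2 (x : Sph2) (t : ℤ) : Lp ℂ 2 P :=
  ((hT.memLp x t).ofReal (K := ℂ)).toLp fun ω => (T x t ω : ℂ)

theorem coeFn_pointL2 (x : Sph2) (t : ℤ) : hT.pointL2 x t =ᵐ[P] fun ω => (T x t ω : ℂ) :=
  MemLp.coeFn_toLp _

theorem inner_pointL2_self (x : Sph2) (t : ℤ) :
    inner ℂ (hT.pointL2 x t) (hT.pointL2 x t) = autocovKernel P T 0 x x := by
  have hnorm : ‖hT.pointL2 x t‖ ^ 2 = autocovKernel P T 0 x x := by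
    rw [norm_sq_eq_integral, ← hT.integral_sq x x t]
    refine integral_congr_ae ?_
    filter_upwards [hT.coeFn_pointL2 x t] with ω hω
    rw [hω, Complex.norm_real, Real.norm_eq_abs, sq_abs]
  rw [inner_self_eq_norm_sq_to_K, ← hnorm]
  exact (Complex.ofReal_pow _ _).symm

variable [SFinite P]

theorem memLp_prod (t : ℤ) : MemLp (fun p : Sph2 × Ω => T p.1 t p.2) 2 (sphArea.prod P) := by
  have hm := (hT.measurable t).aestronglyMeasurable (μ := sphArea.prod P)
  refine (memLp_two_iff_integrable_sq hm).2 ((integrable_prod_iff (hm.pow 2)).2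
    ⟨Eventually.of_forall fun x => (hT.memLp x t).integrable_sq, ?_⟩)
  simp only [Pi.pow_apply, norm_pow, Real.norm_eq_abs, sq_abs, hT.integral_sq _ northPole]
  exact integrable_const _

theorem ae_coeFn_fieldElement (t : ℤ) :
    ∀ᵐ ω ∂P, fieldElement T t ω =ᵐ[sphArea] fun x => (T x t ω : ℂ) := by
  filter_upwards [(hT.memLp_prod t).integrable_sq.prod_left_ae] with ω hω
  have hm : AEStronglyMeasurable (fun x => T x t ω) sphArea :=
    ((hT.measurable t).comp measurable_prodMk_right).aestronglyMeasurable
  have hmem : MemLp (fun x => (T x t ω : ℂ)) 2 sphArea :=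
    ((memLp_two_iff_integrable_sq hm).2 hω).ofReal
  rw [fieldElement, dif_pos hmem]
  exact hmem.coeFn_toLp

theorem ae_norm_sq_fieldElement (t : ℤ) :
    ∀ᵐ ω ∂P, ‖fieldElement T t ω‖ ^ 2 = ∫ x, T x t ω ^ 2 ∂sphArea := by
  filter_upwards [hT.ae_coeFn_fieldElement t] with ω hω
  rw [norm_sq_eq_integral]
  refine integral_congr_ae ?_
  filter_upwards [hω] with x hx
  simp [hx]

theorem ae_inner_fieldElement (hY : IsSphericalHarmonicBasis Y) (i : HarmIndex) (t : ℤ) :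
    ∀ᵐ ω ∂P, inner ℂ (hY.toL2 i) (fieldElement T t ω) = harmonicCoeff Y T i.1 i.2 t ω := by
  filter_upwards [hT.ae_coeFn_fieldElement t] with ω hω
  rw [hY.inner_toL2, harmonicCoeff]
  refine integral_congr_ae ?_
  filter_upwards [hω] with x hx
  rw [hx]

theorem integrable_prod (t : ℤ) {f : Sph2 → ℂ} (hf : Continuous f) {X : Ω → ℂ}
    (hX : MemLp X 2 P) :
    Integrable (fun p : Sph2 × Ω => (T p.1 t p.2 : ℂ) * X p.2 * conj (f p.1))
      (sphArea.prod P) := by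
  obtain ⟨M, hM⟩ := isCompact_univ.exists_bound_of_continuousOn hf.continuousOn
  have hTX : Integrable (fun p : Sph2 × Ω => (T p.1 t p.2 : ℂ) * X p.2) (sphArea.prod P) :=
    (hT.memLp_prod t).ofReal.integrable_mul (hX.comp_snd sphArea)
  have hfm : AEStronglyMeasurable (fun p : Sph2 × Ω => conj (f p.1)) (sphArea.prod P) :=
    ((Complex.continuous_conj.comp hf).comp continuous_id).comp_aestronglyMeasurable
      measurable_fst.aestronglyMeasurable
  exact hTX.mul_bdd (c := M) hfm
    (Eventually.of_forall fun p => by simpa using hM p.1 (Set.mem_univ _))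

end Covariance

section Coefficients

variable [SFinite P] (hT : IsIsotropicStationary P T) (hY : IsSphericalHarmonicBasis Y)

include hT hY

theorem aestronglyMeasurable_fieldElement (t : ℤ) :
    AEStronglyMeasurable (fieldElement T t) P := by
  refine aestronglyMeasurable_of_tendsto_ae (atTop : Filter (Finset HarmIndex))
    (f := fun s ω => ∑ i ∈ s, harmonicCoeff Y T i.1 i.2 t ω • hY.toL2 i) (fun s => ?_) ?_
  · exact Finset.aestronglyMeasurable_fun_sum _ fun i _ =>
      (hT.stronglyMeasurable_harmonicCoeff hY i t).aestronglyMeasurable.smul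
        aestronglyMeasurable_const
  · filter_upwards [ae_all_iff.2 fun i => hT.ae_inner_fieldElement hY i t] with ω hω
    have hsum := hY.hilbertBasis.hasSum_repr (fieldElement T t ω)
    simp_rw [HilbertBasis.repr_apply_apply, hY.hilbertBasis_apply, hω] at hsum
    exact hsum

theorem memLp_fieldElement (t : ℤ) : MemLp (fieldElement T t) 2 P := by
  rw [memLp_two_iff_integrable_sq_norm (hT.aestronglyMeasurable_fieldElement hY t)]
  refine (hT.memLp_prod t).integrable_sq.integral_prod_right.congr ?_
  filter_upwards [hT.ae_norm_sq_fieldElement t] with ω hω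
  rw [hω]

/-- The random element `T_t` as an element of `L²(Ω; L²)`. -/
noncomputable def toL2 (t : ℤ) : Lp SphL2 2 P :=
  (hT.memLp_fieldElement hY t).toLp (fieldElement T t)

theorem coeFn_toL2 (t : ℤ) : hT.toL2 hY t =ᵐ[P] fieldElement T t :=
  (hT.memLp_fieldElement hY t).coeFn_toLp

theorem inner_toL2_self (t : ℤ) (x : Sph2) :
    inner ℂ (hT.toL2 hY t) (hT.toL2 hY t) =
      (sphArea.real Set.univ : ℂ) * autocovKernel P T 0 x x := by
  have hfiber : ∀ᵐ ω ∂P, ‖hT.toL2 hY t ω‖ ^ 2 = ∫ y, T y t ω ^ 2 ∂sphArea := by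
    filter_upwards [hT.coeFn_toL2 hY t, hT.ae_norm_sq_fieldElement t] with ω hfield hsq
    rw [hfield, hsq]
  have hnorm : ‖hT.toL2 hY t‖ ^ 2 = sphArea.real Set.univ * autocovKernel P T 0 x x :=
    calc ‖hT.toL2 hY t‖ ^ 2 = ∫ ω, ∫ y, T y t ω ^ 2 ∂sphArea ∂P := by
          rw [norm_sq_eq_integral, integral_congr_ae hfiber]
      _ = ∫ y, ∫ ω, T y t ω ^ 2 ∂P ∂sphArea :=
          (integral_integral_swap (f := fun y ω => T y t ω ^ 2)
            (hT.memLp_prod t).integrable_sq).symm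
      _ = sphArea.real Set.univ * autocovKernel P T 0 x x := by
          simp_rw [hT.integral_sq _ x, integral_const, smul_eq_mul]
  rw [inner_self_eq_norm_sq_to_K, ← Complex.ofReal_mul, ← hnorm]
  exact (Complex.ofReal_pow _ _).symm

/-- The harmonic coefficient `a_{l,m}(t)` as an element of `L²(Ω)`. -/
noncomputable def coeff (i : HarmIndex) (t : ℤ) : Lp ℂ 2 P :=
  innerLp P (hY.toL2 i) (hT.toL2 hY t)

theorem coeFn_coeff (i : HarmIndex) (t : ℤ) :
    hT.coeff hY i t =ᵐ[P] harmonicCoeff Y T i.1 i.2 t := by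
  filter_upwards [coeFn_innerLp (hY.toL2 i) (hT.toL2 hY t), hT.coeFn_toL2 hY t,
    hT.ae_inner_fieldElement hY i t] with ω hinner hfield hcoeff
  rw [coeff, hinner, hfield, hcoeff]

theorem memLp_harmonicCoeff (i : HarmIndex) (t : ℤ) :
    MemLp (harmonicCoeff Y T i.1 i.2 t) 2 P :=
  (memLp_congr_ae (hT.coeFn_coeff hY i t)).1 (Lp.memLp _)

theorem integral_harmonicCoeff_mul (i : HarmIndex) (t : ℤ) {X : Ω → ℂ} (hX : MemLp X 2 P) :
    ∫ ω, harmonicCoeff Y T i.1 i.2 t ω * X ω ∂P =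
      ∫ x, (∫ ω, (T x t ω : ℂ) * X ω ∂P) * conj (Y i.1 i.2 x) ∂sphArea := by
  simp_rw [harmonicCoeff, ← integral_mul_const, mul_right_comm _ (conj _)]
  exact (integral_integral_swap (f := fun x ω => (T x t ω : ℂ) * X ω * conj (Y i.1 i.2 x))
    (hT.integrable_prod t (hY.continuous i.abs_le) hX)).symm

theorem integral_field_mul_conj_harmonicCoeff (i : HarmIndex) (t s : ℤ) (x : Sph2) :
    ∫ ω, (T x t ω : ℂ) * conj (harmonicCoeff Y T i.1 i.2 s ω) ∂P =
      ∫ y, (autocovKernel P T (t - s) x y : ℂ) * Y i.1 i.2 y ∂sphArea := by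
  have hcov : ∀ y, ∫ ω, (T y s ω : ℂ) * (T x t ω : ℂ) ∂P = autocovKernel P T (t - s) x y :=
    fun y => by
      rw [← hT.integral_mul, ← integral_complex_ofReal]
      simp only [Complex.ofReal_mul, mul_comm]
  have h := congrArg conj (hT.integral_harmonicCoeff_mul hY i s (X := fun ω => (T x t ω : ℂ))
    (hT.memLp x t).ofReal)
  simp_rw [hcov, ← integral_conj, map_mul, Complex.conj_ofReal, Complex.conj_conj] at h
  simpa only [mul_comm] using h

theorem integral_harmonicCoeff_mul_conj (i : HarmIndex) {j : HarmIndex} {t s : ℤ} {c : ℂ}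
    (hc : ∀ x, ∫ y, (autocovKernel P T (t - s) x y : ℂ) * Y j.1 j.2 y ∂sphArea =
      c * Y j.1 j.2 x) :
    ∫ ω, harmonicCoeff Y T i.1 i.2 t ω * conj (harmonicCoeff Y T j.1 j.2 s ω) ∂P =
      if i = j then c else 0 := by
  rw [hT.integral_harmonicCoeff_mul hY i t (X := fun ω => conj (harmonicCoeff Y T j.1 j.2 s ω))
    (hT.memLp_harmonicCoeff hY j s).star]
  simp_rw [hT.integral_field_mul_conj_harmonicCoeff hY, hc, mul_assoc]
  rw [integral_const_mul, hY.orthonormal _ _ _ _ j.abs_le i.abs_le, mul_ite, mul_one, mul_zero]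
  exact if_congr (HarmIndex.ext_iff.symm.trans eq_comm) rfl rfl

end Coefficients

section Expansion

variable [SFinite P] (hT : IsIsotropicStationary P T) (hY : IsSphericalHarmonicBasis Y)
  (hcont : ∀ t : ℤ, Continuous fun p : Sph2 × Sph2 => autocovKernel P T t p.1 p.2)

include hT hY hcont

theorem integral_autocovKernel_mul (i : HarmIndex) (t : ℤ) (x : Sph2) :
    ∫ y, (autocovKernel P T t x y : ℂ) * Y i.1 i.2 y ∂sphArea =
      angularCov P Y T i.1 t * Y i.1 i.2 x := by
  obtain ⟨c, hc⟩ := hY.exists_integral_zonalKernel_eq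
    (k := fun x y => (autocovKernel P T t x y : ℂ))
    (fun x => Complex.continuous_ofReal.comp ((hcont t).comp (Continuous.prodMk_right x)))
    (fun _ _ _ _ h => congrArg Complex.ofReal (hT.isZonalKernel t h)) i.1
  let i₀ : HarmIndex := ⟨i.1, 0, by simp⟩
  have hcov := hT.integral_harmonicCoeff_mul_conj hY i₀ (j := i₀) (t := t) (s := 0) (c := c)
    (by rw [sub_zero]; exact hc _ (hY.harmonicMap_mem_harmSpace i₀))
  rw [if_pos rfl] at hcov
  rw [angularCov, hcov]
  exact hc _ (hY.harmonicMap_mem_harmSpace i) x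

theorem inner_coeff (i j : HarmIndex) (t s : ℤ) :
    inner ℂ (hT.coeff hY j s) (hT.coeff hY i t) =
      if i = j then angularCov P Y T j.1 (t - s) else 0 := by
  rw [← hT.integral_harmonicCoeff_mul_conj hY i fun x =>
    hT.integral_autocovKernel_mul hY hcont j (t - s) x, L2.inner_def]
  refine integral_congr_ae ?_
  filter_upwards [hT.coeFn_coeff hY i t, hT.coeFn_coeff hY j s] with ω hi hj
  rw [hi, hj, RCLike.inner_apply]

theorem inner_coeff_self (i : HarmIndex) (t : ℤ) :
    inner ℂ (hT.coeff hY i t) (hT.coeff hY i t) = angularCov P Y T i.1 0 := by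
  rw [hT.inner_coeff hY hcont, if_pos rfl, sub_self]

theorem summable_angularCov
    (hsum : ∑' t : ℤ, traceNorm (kernelOperator (autocovKernel P T t) (hcont t)) < ∞) :
    Summable fun p : HarmIndex × ℤ => ‖angularCov P Y T p.1.1 p.2‖ := by
  have h : ∑' p : ℤ × HarmIndex, ENNReal.ofReal ‖angularCov P Y T p.2.1 p.1‖ < ∞ := by
    rw [ENNReal.tsum_prod']
    exact (ENNReal.tsum_le_tsum fun t => hY.tsum_norm_eigenvalue_le_traceNorm (hcont t)
      fun i => hT.integral_autocovKernel_mul hY hcont i t).trans_lt hsum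
  rw [← (Equiv.prodComm ℤ HarmIndex).summable_iff]
  refine (ENNReal.summable_toReal h.ne).congr fun p => ?_
  simp

theorem hasSum_angularCov_zero (x : Sph2) :
    HasSum (fun l : ℕ => angularCov P Y T l 0 * hY.zonalHarmonic l x x)
      (autocovKernel P T 0 x x : ℂ) := by
  have hA : (sphArea.real Set.univ : ℂ) ≠ 0 := by exact_mod_cast sphArea_real_univ_pos.ne'
  have hcoeff : HasSum (fun i : HarmIndex => angularCov P Y T i.1 0)
      ((sphArea.real Set.univ : ℂ) * autocovKernel P T 0 x x) := by
    rw [← hT.inner_toL2_self hY 0 x]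
    refine (hasSum_inner_innerLp hY.hilbertBasis (hT.toL2 hY 0) (hT.toL2 hY 0)).congr_fun
      fun i => ?_
    rw [hY.hilbertBasis_apply, ← hT.inner_coeff_self hY hcont i 0, coeff]
  rw [← hasSum_mul_left_iff hA]
  refine (HarmIndex.hasSum_fst (g := fun l => angularCov P Y T l 0) hcoeff).congr_fun fun l => ?_
  rw [mul_left_comm, hY.sphArea_mul_zonalHarmonic_self, nsmul_eq_mul, mul_comm]
  push_cast
  rfl

theorem inner_coeff_pointL2 (i : HarmIndex) (t : ℤ) (x : Sph2) :
    inner ℂ (hT.coeff hY i t) (hT.pointL2 x t) =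
      Y i.1 i.2 x * inner ℂ (hT.coeff hY i t) (hT.coeff hY i t) := by
  rw [hT.inner_coeff_self hY hcont, ← sub_self t, mul_comm,
    ← hT.integral_autocovKernel_mul hY hcont, ← hT.integral_field_mul_conj_harmonicCoeff hY,
    L2.inner_def]
  refine integral_congr_ae ?_
  filter_upwards [hT.coeFn_coeff hY i t, hT.coeFn_pointL2 x t] with ω hcoeff hpoint
  rw [hcoeff, hpoint, RCLike.inner_apply]

theorem inner_sub_expansion_self (s : Finset ℕ) (t : ℤ) (x : Sph2) :
    let S := ∑ i ∈ s.sigma fun l => (Finset.univ : Finset (Finset.Icc (-(l : ℤ)) l)),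
      Y i.1 i.2 x • hT.coeff hY i t
    inner ℂ (hT.pointL2 x t - S) (hT.pointL2 x t - S) =
      autocovKernel P T 0 x x - ∑ l ∈ s, angularCov P Y T l 0 * hY.zonalHarmonic l x x := by
  intro S
  rw [inner_sub_sum_self_of_orthogonal _
    (fun i _ j _ hij => by rw [hT.inner_coeff hY hcont, if_neg hij.symm])
    (fun i _ => hT.inner_coeff_pointL2 hY hcont i t x), hT.inner_pointL2_self]
  simp_rw [hT.inner_coeff_self hY hcont]
  rw [HarmIndex.sum_sigma_univ s fun l m => Y l m x * conj (Y l m x) * angularCov P Y T l 0]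
  congr 1
  refine Finset.sum_congr rfl fun l _ => ?_
  rw [hY.zonalHarmonic_apply, Finset.mul_sum,
    ← Finset.sum_coe_sort (Finset.Icc (-(l : ℤ)) l)]
  exact Finset.sum_congr rfl fun m _ => mul_comm _ _

theorem lintegral_sub_expansion_sq (s : Finset ℕ) (t : ℤ) (x : Sph2) :
    ∫⁻ ω, ‖(T x t ω : ℂ) - ∑ l ∈ s, ∑ m ∈ Finset.Icc (-(l : ℤ)) l,
        harmonicCoeff Y T l m t ω * Y l m x‖ₑ ^ 2 ∂P =
      ENNReal.ofReal (autocovKernel P T 0 x x -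
        ∑ l ∈ s, angularCov P Y T l 0 * hY.zonalHarmonic l x x : ℂ).re := by
  rw [← hT.inner_sub_expansion_self hY hcont s t x]
  set S := ∑ i ∈ s.sigma fun l => (Finset.univ : Finset (Finset.Icc (-(l : ℤ)) l)),
    Y i.1 i.2 x • hT.coeff hY i t
  have hae : ∀ᵐ ω ∂P, (hT.pointL2 x t - S) ω = (T x t ω : ℂ) -
      ∑ l ∈ s, ∑ m ∈ Finset.Icc (-(l : ℤ)) l, harmonicCoeff Y T l m t ω * Y l m x := by
    filter_upwards [Lp.coeFn_sub (hT.pointL2 x t) S, hT.coeFn_pointL2 x t,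
      coeFn_sum_smul _ (fun i => Y i.1 i.2 x) fun i _ => hT.coeFn_coeff hY i t]
      with ω hsub hpoint hsum
    rw [hsub, Pi.sub_apply, hpoint, hsum,
      HarmIndex.sum_sigma_univ s fun l m => Y l m x • harmonicCoeff Y T l m t ω]
    simp_rw [smul_eq_mul, mul_comm]
  rw [lintegral_congr_ae (hae.mono fun ω hω => by rw [← hω]), ← enorm_sq_eq_lintegral,
    ← ofReal_norm, ← ENNReal.ofReal_pow (norm_nonneg _)]
  exact congrArg ENNReal.ofReal (norm_sq_eq_re_inner (𝕜 := ℂ) _)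

theorem tendsto_expansion (t : ℤ) (x : Sph2) :
    Tendsto (fun L : ℕ => ∫⁻ ω, ‖(T x t ω : ℂ) - ∑ l ∈ Finset.range (L + 1),
      ∑ m ∈ Finset.Icc (-(l : ℤ)) l, harmonicCoeff Y T l m t ω * Y l m x‖ₑ ^ 2 ∂P)
      atTop (𝓝 0) := by
  simp_rw [hT.lintegral_sub_expansion_sq hY hcont]
  have h := ((hT.hasSum_angularCov_zero hY hcont x).tendsto_sum_nat.comp
    (tendsto_add_atTop_nat 1)).const_sub (autocovKernel P T 0 x x : ℂ)
  rw [sub_self] at h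
  simpa using ENNReal.tendsto_ofReal ((Complex.continuous_re.tendsto _).comp h)

end Expansion

end IsIsotropicStationary

/-! ### Fourier analysis on `(-π, π]` -/

/-- Lebesgue measure on the frequency interval `(-π, π]`. -/
noncomputable abbrev freqMeasure : Measure ℝ := volume.restrict (Set.Ioc (-Real.pi) Real.pi)

/-- The Hilbert space of square-integrable functions on the frequency interval. -/
abbrev FreqL2 : Type := Lp ℂ 2 freqMeasure

section Characters

theorem continuous_charFn (t : ℤ) : Continuous (charFn t) := by
  unfold charFn
  fun_prop

theorem norm_charFn (t : ℤ) (ν : ℝ) : ‖charFn t ν‖ = 1 := by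
  have : Complex.I * t * ν = ((t * ν : ℝ) : ℂ) * Complex.I := by push_cast; ring
  rw [charFn, this, Complex.norm_exp_ofReal_mul_I]

theorem conj_charFn (t : ℤ) (ν : ℝ) : conj (charFn t ν) = charFn (-t) ν := by
  rw [charFn, charFn, ← Complex.exp_conj]
  simp

theorem charFn_mul (s t : ℤ) (ν : ℝ) : charFn s ν * charFn t ν = charFn (s + t) ν := by
  rw [charFn, charFn, charFn, ← Complex.exp_add]
  congr 1
  push_cast
  ring

theorem integral_charFn (t : ℤ) :
    ∫ ν, charFn t ν ∂freqMeasure = if t = 0 then (2 * Real.pi : ℂ) else 0 := by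
  rw [← intervalIntegral.integral_of_le (by linarith [Real.pi_pos])]
  split_ifs with ht
  · subst ht
    simp [charFn]
    ring
  · have hc : Complex.I * t ≠ 0 := mul_ne_zero Complex.I_ne_zero (by exact_mod_cast ht)
    simp only [charFn]
    rw [integral_exp_mul_complex hc, div_eq_zero_iff]
    refine Or.inl (sub_eq_zero.2 (Complex.exp_eq_exp_iff_exists_int.2 ⟨t, ?_⟩))
    push_cast
    ring

theorem memLp_charFn (p : ℝ≥0∞) (t : ℤ) : MemLp (charFn t) p freqMeasure :=
  MemLp.of_bound (continuous_charFn t).aestronglyMeasurable 1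
    (Eventually.of_forall fun ν => (norm_charFn t ν).le)

/-- The character `ν ↦ e^{itν}` as an element of `L²(-π, π)`. -/
noncomputable def charL2 (t : ℤ) : FreqL2 := (memLp_charFn 2 t).toLp (charFn t)

theorem coeFn_charL2 (t : ℤ) : charL2 t =ᵐ[freqMeasure] charFn t := (memLp_charFn 2 t).coeFn_toLp

theorem inner_charL2 (t : ℤ) (f : FreqL2) :
    inner ℂ (charL2 t) f = ∫ ν, f ν * conj (charFn t ν) ∂freqMeasure := by
  rw [L2.inner_def]
  refine integral_congr_ae ?_
  filter_upwards [coeFn_charL2 t] with ν hν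
  rw [hν, RCLike.inner_apply]

theorem fourierCoeffOn_eq_inner_charL2 (f : FreqL2) (t : ℤ) :
    fourierCoeffOn (by linarith [Real.pi_pos] : -Real.pi < Real.pi) f t =
      (1 / (Real.pi - -Real.pi)) • inner ℂ (charL2 t) f := by
  rw [fourierCoeffOn_eq_integral, intervalIntegral.integral_of_le (by linarith [Real.pi_pos]),
    inner_charL2]
  congr 1
  refine integral_congr_ae (Eventually.of_forall fun ν => ?_)
  beta_reduce
  rw [conj_charFn, smul_eq_mul, fourier_coe_apply, charFn, mul_comm]
  congr 2
  have : (Real.pi : ℂ) ≠ 0 := by exact_mod_cast Real.pi_ne_zero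
  push_cast
  field_simp
  ring

theorem eq_zero_of_inner_charL2_eq_zero (f : FreqL2) (hf : ∀ t, inner ℂ (charL2 t) f = 0) :
    f = 0 := by
  have hlt : -Real.pi < Real.pi := by linarith [Real.pi_pos]
  have parseval := hasSum_sq_fourierCoeffOn hlt (f := f) (Lp.memLp f)
  simp only [fourierCoeffOn_eq_inner_charL2, hf, smul_zero, norm_zero, ne_eq,
    OfNat.ofNat_ne_zero, not_false_eq_true, zero_pow] at parseval
  have hnorm := parseval.unique hasSum_zero
  rw [intervalIntegral.integral_of_le hlt.le, ← norm_sq_eq_integral] at hnorm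
  simpa using (smul_eq_zero.1 hnorm).resolve_left (inv_ne_zero (sub_pos.2 hlt).ne')

theorem topologicalClosure_span_charL2 :
    (Submodule.span ℂ (Set.range charL2)).topologicalClosure = ⊤ := by
  rw [Submodule.topologicalClosure_eq_top_iff, Submodule.eq_bot_iff]
  intro f hf
  refine eq_zero_of_inner_charL2_eq_zero f fun t => ?_
  exact (Submodule.mem_orthogonal _ _).1 hf _ (Submodule.subset_span ⟨t, rfl⟩)

theorem ext_inner_charL2 {f g : FreqL2}
    (h : ∀ t, inner ℂ (charL2 t) f = inner ℂ (charL2 t) g) : f = g := by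
  refine sub_eq_zero.1 (eq_zero_of_inner_charL2_eq_zero _ fun t => ?_)
  rw [inner_sub_right, h, sub_self]

end Characters

section SpectralOp

variable {G : Type*} [NormedAddCommGroup G] [InnerProductSpace ℂ G] {B : FreqL2 →L[ℂ] FreqL2}

theorem norm_linearCombination_le_of_inner_eq {v : ℤ → G}
    (h : ∀ s t, inner ℂ (v s) (v t) = inner ℂ (charL2 s) (B (charL2 t))) (c : ℤ →₀ ℂ) :
    ‖Finsupp.linearCombination ℂ v c‖ ≤
      √‖B‖ * ‖Finsupp.linearCombination ℂ charL2 c‖ := by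
  set f : FreqL2 := Finsupp.linearCombination ℂ charL2 c with hf
  have hinner : inner ℂ (Finsupp.linearCombination ℂ v c) (Finsupp.linearCombination ℂ v c) =
      inner ℂ f (B f) := by
    simp only [hf, Finsupp.linearCombination_apply, Finsupp.sum, map_sum, map_smul, sum_inner,
      inner_sum, inner_smul_left, inner_smul_right, h]
  have hsq : ‖Finsupp.linearCombination ℂ v c‖ ^ 2 ≤ ‖B‖ * ‖f‖ ^ 2 := by
    calc ‖Finsupp.linearCombination ℂ v c‖ ^ 2 = ‖inner ℂ f (B f)‖ := by
          rw [← hinner, inner_self_eq_norm_sq_to_K]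
          simp
      _ ≤ ‖f‖ * (‖B‖ * ‖f‖) := (norm_inner_le_norm _ _).trans (by gcongr; exact B.le_opNorm f)
      _ = ‖B‖ * ‖f‖ ^ 2 := by ring
  rwa [← pow_le_pow_iff_left₀ (norm_nonneg _) (by positivity) two_ne_zero, mul_pow,
    Real.sq_sqrt (norm_nonneg B)]

variable [CompleteSpace G]

theorem inner_apply_eq_of_charL2 {A A' : FreqL2 →L[ℂ] G}
    (h : ∀ s t, inner ℂ (A (charL2 s)) (A' (charL2 t)) = inner ℂ (charL2 s) (B (charL2 t)))
    (f g : FreqL2) : inner ℂ (A f) (A' g) = inner ℂ f (B g) := by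
  have hB : (ContinuousLinearMap.adjoint A).comp A' = B := by
    refine ContinuousLinearMap.ext_on (Submodule.dense_iff_topologicalClosure_eq_top.2
      topologicalClosure_span_charL2) ?_
    rintro _ ⟨t, rfl⟩
    refine ext_inner_charL2 fun s => ?_
    rw [ContinuousLinearMap.comp_apply, ContinuousLinearMap.adjoint_inner_right, h]
  rw [← hB, ContinuousLinearMap.comp_apply, ContinuousLinearMap.adjoint_inner_right]

/-- The bounded operator on `L²(-π, π)` that maps the character `ν ↦ e^{itν}` to `v t`. It has
this property when such an operator exists, for instance under the hypothesis of
`spectralOp_charL2`. -/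
noncomputable def spectralOp (v : ℤ → G) : FreqL2 →L[ℂ] G :=
  (Finsupp.linearCombination ℂ v).extendOfNorm (Finsupp.linearCombination ℂ charL2)

theorem spectralOp_charL2 {v : ℤ → G}
    (h : ∀ s t, inner ℂ (v s) (v t) = inner ℂ (charL2 s) (B (charL2 t))) (t : ℤ) :
    spectralOp v (charL2 t) = v t := by
  have hdense : DenseRange (Finsupp.linearCombination ℂ charL2) := by
    rw [DenseRange, ← LinearMap.coe_range, Finsupp.range_linearCombination,
      Submodule.dense_iff_topologicalClosure_eq_top]
    exact topologicalClosure_span_charL2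
  have := LinearMap.extendOfNorm_eq hdense ⟨_, norm_linearCombination_le_of_inner_eq h⟩
    (Finsupp.single t 1)
  simpa only [spectralOp, Finsupp.linearCombination_single, one_smul] using this

end SpectralOp

section Multiplication

/-- Multiplication of functions on the frequency interval by bounded functions. -/
noncomputable def freqMul : Lp ℂ ∞ freqMeasure →L[ℂ] FreqL2 →L[ℂ] FreqL2 :=
  (ContinuousLinearMap.mul ℂ ℂ).holderL freqMeasure ∞ 2 2

theorem coeFn_freqMul (ψ : Lp ℂ ∞ freqMeasure) (f : FreqL2) :
    freqMul ψ f =ᵐ[freqMeasure] fun ν => ψ ν * f ν :=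
  (ContinuousLinearMap.mul ℂ ℂ).coeFn_holder ψ f

theorem inner_freqMul (ψ : Lp ℂ ∞ freqMeasure) (f g : FreqL2) :
    inner ℂ f (freqMul ψ g) = ∫ ν, ψ ν * (g ν * conj (f ν)) ∂freqMeasure := by
  rw [L2.inner_def]
  refine integral_congr_ae ?_
  filter_upwards [coeFn_freqMul ψ g] with ν hν
  rw [hν, RCLike.inner_apply, mul_assoc]

theorem inner_charL2_freqMul (ψ : Lp ℂ ∞ freqMeasure) (s t : ℤ) :
    inner ℂ (charL2 s) (freqMul ψ (charL2 t)) = ∫ ν, ψ ν * charFn (t - s) ν ∂freqMeasure := by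
  rw [inner_freqMul]
  refine integral_congr_ae ?_
  filter_upwards [coeFn_charL2 s, coeFn_charL2 t] with ν hs ht
  rw [hs, ht, conj_charFn, charFn_mul, sub_eq_add_neg]

/-- The indicator function of the frequencies up to `ν`, as an element of `L²(-π, π)`. -/
noncomputable def freqInd (ν : ℝ) : FreqL2 :=
  indicatorConstLp 2 (measurableSet_Iic (a := ν)) (measure_ne_top freqMeasure _) 1

theorem coeFn_freqInd (ν : ℝ) :
    freqInd ν =ᵐ[freqMeasure] (Set.Iic ν).indicator fun _ => (1 : ℂ) :=
  indicatorConstLp_coeFn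

theorem freqInd_neg_pi : freqInd (-Real.pi) = 0 := by
  refine Lp.ext ?_
  filter_upwards [coeFn_freqInd (-Real.pi), Lp.coeFn_zero ℂ 2 freqMeasure,
    ae_restrict_mem measurableSet_Ioc] with θ hind hzero hθ
  rw [hind, hzero, Set.indicator_of_notMem (by simpa using hθ.1), Pi.zero_apply]

theorem inner_freqInd_freqMul (ψ : Lp ℂ ∞ freqMeasure) {a b : ℝ}
    (ha : a ∈ Set.Icc (-Real.pi) Real.pi) (hb : b ∈ Set.Icc (-Real.pi) Real.pi) :
    inner ℂ (freqInd a) (freqMul ψ (freqInd b)) = ∫ θ in (-Real.pi)..min a b, ψ θ := by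
  have hprod : ∀ᵐ θ ∂freqMeasure, ψ θ * (freqInd b θ * conj (freqInd a θ)) =
      (Set.Iic (min a b)).indicator ψ θ := by
    filter_upwards [coeFn_freqInd a, coeFn_freqInd b] with θ hfa hfb
    rw [hfa, hfb]
    by_cases hθa : θ ≤ a <;> by_cases hθb : θ ≤ b <;> simp [Set.indicator, hθa, hθb]
  have hinter : Set.Iic (min a b) ∩ Set.Ioc (-Real.pi) Real.pi = Set.Ioc (-Real.pi) (min a b) := by
    rw [Set.inter_comm, ← Set.Ioi_inter_Iic, ← Set.Ioi_inter_Iic, Set.inter_assoc,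
      Set.Iic_inter_Iic, min_eq_right ((min_le_left a b).trans ha.2)]
  rw [inner_freqMul, integral_congr_ae hprod, integral_indicator measurableSet_Iic,
    Measure.restrict_restrict measurableSet_Iic, hinter,
    intervalIntegral.integral_of_le (le_min ha.1 hb.1)]

end Multiplication

/-! ### Spectral densities -/

section Density

variable {Ω : Type*} [MeasurableSpace Ω] {P : Measure Ω}
  {T : Sph2 → ℤ → Ω → ℝ} {Y : ℕ → ℤ → Sph2 → ℂ} {l : ℕ}

theorem spectralDensity_eq (ν : ℝ) : spectralDensity P Y T l ν =
    (2 * Real.pi : ℂ)⁻¹ * ∑' t : ℤ, charFn (-t) ν * angularCov P Y T l t := by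
  simp [spectralDensity, charFn]

theorem continuous_spectralDensity (h : Summable fun t => ‖angularCov P Y T l t‖) :
    Continuous (spectralDensity P Y T l) := by
  rw [show spectralDensity P Y T l = _ from funext spectralDensity_eq]
  refine continuous_const.mul (continuous_tsum
    (fun t => (continuous_charFn (-t)).mul continuous_const) h fun t ν => ?_)
  rw [norm_mul, norm_charFn, one_mul]

theorem norm_spectralDensity_le (h : Summable fun t => ‖angularCov P Y T l t‖) (ν : ℝ) :
    ‖spectralDensity P Y T l ν‖ ≤ (2 * Real.pi)⁻¹ * ∑' t : ℤ, ‖angularCov P Y T l t‖ := by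
  have hs : Summable fun t : ℤ => ‖charFn (-t) ν * angularCov P Y T l t‖ := by
    simpa [norm_mul, norm_charFn] using h
  have hpi : ‖(2 * Real.pi : ℂ)⁻¹‖ = (2 * Real.pi)⁻¹ := by
    simp [abs_of_pos Real.pi_pos]
  rw [spectralDensity_eq, norm_mul, hpi]
  gcongr
  exact (norm_tsum_le_tsum_norm hs).trans_eq (by simp [norm_charFn])

theorem integral_spectralDensity_mul_charFn (h : Summable fun t => ‖angularCov P Y T l t‖)
    (n : ℤ) : ∫ ν, spectralDensity P Y T l ν * charFn n ν ∂freqMeasure = angularCov P Y T l n := by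
  have hint (t : ℤ) : Integrable (fun ν => charFn (n - t) ν * angularCov P Y T l t) freqMeasure :=
    ((memLp_charFn 1 (n - t)).integrable le_rfl).mul_const _
  have hsum := hasSum_integral_of_summable_integral_norm hint (by
    simp only [norm_mul, norm_charFn, one_mul, integral_const, smul_eq_mul]
    exact h.mul_left _)
  have hpi : (2 * Real.pi : ℂ) ≠ 0 := by simp [Real.pi_ne_zero]
  have hseries (ν : ℝ) : spectralDensity P Y T l ν * charFn n ν =
      (2 * Real.pi : ℂ)⁻¹ * ∑' t : ℤ, charFn (n - t) ν * angularCov P Y T l t := by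
    rw [spectralDensity_eq, mul_assoc, ← tsum_mul_right]
    congr 2
    ext t
    rw [mul_right_comm, charFn_mul, neg_add_eq_sub]
  simp_rw [hseries]
  rw [integral_const_mul, ← hsum.tsum_eq]
  simp_rw [integral_mul_const, integral_charFn]
  rw [tsum_eq_single n fun t ht => by rw [if_neg (sub_ne_zero.2 ht.symm), zero_mul],
    if_pos (sub_self n), inv_mul_cancel_left₀ hpi]

/-- The spectral density as a bounded function on the frequency interval. -/
noncomputable def specDensity (h : Summable fun t => ‖angularCov P Y T l t‖) :
    Lp ℂ ∞ freqMeasure :=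
  (MemLp.of_bound (continuous_spectralDensity h).aestronglyMeasurable _
    (Eventually.of_forall (norm_spectralDensity_le h))).toLp (spectralDensity P Y T l)

theorem coeFn_specDensity (h : Summable fun t => ‖angularCov P Y T l t‖) :
    specDensity h =ᵐ[freqMeasure] spectralDensity P Y T l :=
  MemLp.coeFn_toLp _

theorem norm_specDensity_le (h : Summable fun t => ‖angularCov P Y T l t‖) :
    ‖specDensity h‖ ≤ (2 * Real.pi)⁻¹ * ∑' t : ℤ, ‖angularCov P Y T l t‖ := by
  have := Lp.norm_le_of_ae_bound (f := specDensity h) (by positivity)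
    ((coeFn_specDensity h).mono fun ν hν => hν ▸ norm_spectralDensity_le h ν)
  simpa using this

theorem inner_charL2_freqMul_specDensity (h : Summable fun t => ‖angularCov P Y T l t‖)
    (s t : ℤ) : inner ℂ (charL2 s) (freqMul (specDensity h) (charL2 t)) =
      angularCov P Y T l (t - s) := by
  rw [inner_charL2_freqMul, ← integral_spectralDensity_mul_charFn h]
  refine integral_congr_ae ((coeFn_specDensity h).mono fun ν hν => ?_)
  beta_reduce
  rw [hν]

theorem inner_freqInd_freqMul_specDensity (h : Summable fun t => ‖angularCov P Y T l t‖)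
    {a b : ℝ} (ha : a ∈ Set.Icc (-Real.pi) Real.pi) (hb : b ∈ Set.Icc (-Real.pi) Real.pi) :
    inner ℂ (freqInd a) (freqMul (specDensity h) (freqInd b)) =
      ∫ θ in (-Real.pi)..min a b, spectralDensity P Y T l θ := by
  have hle : -Real.pi ≤ min a b := le_min ha.1 hb.1
  rw [inner_freqInd_freqMul _ ha hb, intervalIntegral.integral_of_le hle,
    intervalIntegral.integral_of_le hle]
  exact integral_congr_ae (ae_restrict_of_ae_restrict_of_subset
    (Set.Ioc_subset_Ioc_right ((min_le_left a b).trans ha.2)) (coeFn_specDensity h))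

end Density

/-! ### Mean-square Stieltjes integrals -/

theorem exists_nat_mul_eq_and_lt {x δ : ℝ} (hx : 0 ≤ x) (hδ : 0 < δ) :
    ∃ (n : ℕ) (a : ℝ), n * a = x ∧ a < δ ∧ (0 < n → 0 < a) := by
  rcases hx.eq_or_lt with rfl | hx
  · exact ⟨0, 0, by simp, hδ, by simp⟩
  · obtain ⟨n, hn⟩ := exists_nat_gt (x / δ)
    have hn0 : (0 : ℝ) < n := (div_pos hx hδ).trans hn
    exact ⟨n, x / n, by field_simp, (div_lt_comm₀ hδ hn0).1 hn, fun _ => div_pos hx hn0⟩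

/-- A partition `point 0 < ⋯ < point size` of the frequency interval `[-π, π]`; the values of
`point` beyond `size` are irrelevant. -/
structure FreqPartition where
  size : ℕ
  point : ℕ → ℝ
  first : point 0 = -Real.pi
  last : point size = Real.pi
  lt : ∀ j < size, point j < point (j + 1)

namespace FreqPartition

theorem mono (p : FreqPartition) {i j : ℕ} (hij : i ≤ j) (hj : j ≤ p.size) :
    p.point i ≤ p.point j := by
  induction j, hij using Nat.le_induction with
  | base => exact le_rfl
  | succ j _ ih => exact (ih (by omega)).trans (p.lt j (by omega)).le

theorem mem_Icc (p : FreqPartition) {j : ℕ} (hj : j ≤ p.size) :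
    p.point j ∈ Set.Icc (-Real.pi) Real.pi :=
  ⟨p.first ▸ p.mono (Nat.zero_le j) hj, p.last ▸ p.mono hj le_rfl⟩

theorem exists_mem_Ioc (p : FreqPartition) {ν : ℝ} (hν : ν ∈ Set.Ioc (-Real.pi) Real.pi) :
    ∃ j < p.size, ν ∈ Set.Ioc (p.point j) (p.point (j + 1)) := by
  classical
  have hex : ∃ j, ν ≤ p.point j := ⟨p.size, p.last ▸ hν.2⟩
  have hpos : Nat.find hex ≠ 0 := fun h => by
    have := Nat.find_spec hex
    rw [h, p.first] at this
    exact not_lt.2 this hν.1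
  obtain ⟨j, hj⟩ := Nat.exists_eq_succ_of_ne_zero hpos
  have hle : Nat.find hex ≤ p.size := Nat.find_min' hex (p.last ▸ hν.2)
  have hspec := Nat.find_spec hex
  rw [hj] at hspec
  exact ⟨j, by omega, not_le.1 (Nat.find_min hex (by omega)), hspec⟩

theorem exists_point_eq {ν δ : ℝ} (hν : ν ∈ Set.Icc (-Real.pi) Real.pi) (hδ : 0 < δ) :
    ∃ p : FreqPartition, (∀ j < p.size, p.point (j + 1) - p.point j < δ) ∧
      ∃ k ≤ p.size, p.point k = ν := by
  obtain ⟨m, a, hma, haδ, ha⟩ := exists_nat_mul_eq_and_lt (sub_nonneg.2 hν.1) hδ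
  obtain ⟨n, b, hnb, hbδ, hb⟩ := exists_nat_mul_eq_and_lt (sub_nonneg.2 hν.2) hδ
  let u : ℕ → ℝ := fun j => -Real.pi + min j m * a + (j - m : ℕ) * b
  have hstep : ∀ j < m + n, 0 < u (j + 1) - u j ∧ u (j + 1) - u j < δ := by
    intro j hj
    rcases lt_or_ge j m with hjm | hmj
    · have : u (j + 1) - u j = a := by
        simp only [u, min_eq_left hjm.le, min_eq_left (Nat.succ_le_of_lt hjm),
          Nat.sub_eq_zero_of_le hjm.le, Nat.sub_eq_zero_of_le (Nat.succ_le_of_lt hjm)]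
        push_cast
        ring
      exact this ▸ ⟨ha (by omega), haδ⟩
    · have : u (j + 1) - u j = b := by
        simp only [u, min_eq_right hmj, min_eq_right (hmj.trans (Nat.le_succ j)),
          Nat.succ_sub hmj]
        push_cast
        ring
      exact this ▸ ⟨hb (by omega), hbδ⟩
  have hlast : u (m + n) = Real.pi := by
    simp only [u, min_eq_right (Nat.le_add_right m n), Nat.add_sub_cancel_left]
    linarith
  have hthrough : u m = ν := by
    simp only [u, min_self, Nat.sub_self, Nat.cast_zero, zero_mul]
    linarith
  exact ⟨⟨m + n, u, by simp [u], hlast, fun j hj => sub_pos.1 (hstep j hj).1⟩,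
    fun j hj => (hstep j hj).2, m, Nat.le_add_right m n, hthrough⟩

end FreqPartition

/-- The filter of partitions of `[-π, π]` whose mesh tends to zero. -/
def fineMesh : Filter FreqPartition :=
  ⨅ δ ∈ Set.Ioi (0 : ℝ), 𝓟 {p | ∀ j < p.size, p.point (j + 1) - p.point j < δ}

theorem fineMesh_hasBasis : fineMesh.HasBasis (fun δ : ℝ => 0 < δ)
    fun δ => {p | ∀ j < p.size, p.point (j + 1) - p.point j < δ} := by
  refine hasBasis_biInf_principal
    (fun δ₁ h₁ δ₂ h₂ => ⟨min δ₁ δ₂, Set.mem_Ioi.2 (lt_min h₁ h₂), ?_, ?_⟩)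
    ⟨1, Set.mem_Ioi.2 one_pos⟩
  · exact fun p hp j hj => (hp j hj).trans_le (min_le_left _ _)
  · exact fun p hp j hj => (hp j hj).trans_le (min_le_right _ _)

theorem fineMesh_inf_principal_neBot {ν : ℝ} (hν : ν ∈ Set.Icc (-Real.pi) Real.pi) :
    (fineMesh ⊓ 𝓟 {p | ∃ k ≤ p.size, p.point k = ν}).NeBot :=
  fineMesh_hasBasis.inf_principal_neBot_iff.2 fun {_} hδ =>
    (FreqPartition.exists_point_eq hν hδ).imp fun _ hp => ⟨hp.1, hp.2⟩

/-- The Riemann–Stieltjes sum `∑ g(u_j) (Z_{u_{j+1}} - Z_{u_j})` over a partition, as a linear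
function of the integrand. -/
def stieltjesSum {E : Type*} [AddCommGroup E] [Module ℂ E] (Z : ℝ → E) (p : FreqPartition) :
    (ℝ → ℂ) →ₗ[ℂ] E :=
  ∑ j ∈ Finset.range p.size,
    (LinearMap.proj (p.point j)).smulRight (Z (p.point (j + 1)) - Z (p.point j))

section StieltjesSum

variable {E F : Type*} [AddCommGroup E] [Module ℂ E] [AddCommGroup F] [Module ℂ F]

theorem stieltjesSum_apply (Z : ℝ → E) (p : FreqPartition) (g : ℝ → ℂ) :
    stieltjesSum Z p g = ∑ j ∈ Finset.range p.size,
      g (p.point j) • (Z (p.point (j + 1)) - Z (p.point j)) := by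
  simp [stieltjesSum]

theorem map_stieltjesSum (A : E →ₗ[ℂ] F) (Z : ℝ → E) (p : FreqPartition) (g : ℝ → ℂ) :
    A (stieltjesSum Z p g) = stieltjesSum (fun ν => A (Z ν)) p g := by
  simp only [stieltjesSum_apply, map_sum, map_smul, map_sub]

theorem stieltjesSum_indicator_Iio (Z : ℝ → E) {p : FreqPartition} {k : ℕ} (hk : k ≤ p.size) :
    stieltjesSum Z p ((Set.Iio (p.point k)).indicator 1) = Z (p.point k) - Z (-Real.pi) := by
  rw [stieltjesSum_apply, ← p.first, ← Finset.sum_range_sub (fun j => Z (p.point j)) k,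
    ← Finset.sum_subset (Finset.range_subset_range.2 hk)]
  · refine Finset.sum_congr rfl fun j hj => ?_
    have hjk := Finset.mem_range.1 hj
    have hlt : p.point j < p.point k := (p.lt j (by omega)).trans_le (p.mono hjk hk)
    rw [Set.indicator_of_mem (Set.mem_Iio.2 hlt), Pi.one_apply, one_smul]
  · intro j hj hjk
    have hle : p.point k ≤ p.point j :=
      p.mono (by simpa using hjk) (Finset.mem_range.1 hj).le
    rw [Set.indicator_of_notMem (Set.notMem_Iio.2 hle), zero_smul]

theorem stieltjesSum_indicator_Iic {p : FreqPartition} (g : ℝ → ℂ) {θ : ℝ} {j : ℕ}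
    (hj : j < p.size) (hθ : θ ∈ Set.Ioc (p.point j) (p.point (j + 1))) :
    stieltjesSum (fun ν => (Set.Iic ν).indicator (fun _ => (1 : ℂ)) θ) p g = g (p.point j) := by
  rw [stieltjesSum_apply, Finset.sum_eq_single_of_mem j (Finset.mem_range.2 hj)]
  · rw [Set.indicator_of_mem (Set.mem_Iic.2 hθ.2), Set.indicator_of_notMem (Set.notMem_Iic.2 hθ.1),
      sub_zero, smul_eq_mul, mul_one]
  · intro i hi hij
    have hi' := Finset.mem_range.1 hi
    rcases lt_or_gt_of_ne hij with hlt | hgt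
    · have h₁ : p.point (i + 1) < θ := (p.mono hlt hj.le).trans_lt hθ.1
      rw [Set.indicator_of_notMem (Set.notMem_Iic.2 h₁),
        Set.indicator_of_notMem (Set.notMem_Iic.2 ((p.lt i hi').trans h₁)), sub_self, smul_zero]
    · have h₀ : θ ≤ p.point i := hθ.2.trans (p.mono hgt hi'.le)
      rw [Set.indicator_of_mem (Set.mem_Iic.2 (h₀.trans (p.lt i hi').le)),
        Set.indicator_of_mem (Set.mem_Iic.2 h₀), sub_self, smul_zero]

end StieltjesSum

section MeanSquare

variable {Ω : Type*} [MeasurableSpace Ω] {P : Measure Ω} {E : Type*} [NormedAddCommGroup E]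
  [NormedSpace ℂ E]

theorem isStieltjesIntegral_iff {g : ℝ → ℂ} {Z : ℝ → Ω → E} {I : Ω → E} :
    IsStieltjesIntegral P g Z I ↔ MemLp I 2 P ∧ Tendsto
      (fun p => ∫⁻ ω, ‖I ω - stieltjesSum (fun ν => Z ν ω) p g‖ₑ ^ 2 ∂P) fineMesh (𝓝 0) := by
  refine and_congr_right fun _ => ?_
  simp only [(fineMesh_hasBasis.tendsto_iff ENNReal.nhds_zero_basis), stieltjesSum_apply]
  refine forall₂_congr fun ε _ => exists_congr fun δ => and_congr_right fun _ => ?_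
  exact ⟨fun h p hp => h p.size p.point p.first p.last p.lt hp,
    fun h J u h0 hJ hlt hmesh => h ⟨J, u, h0, hJ, hlt⟩ hmesh⟩

theorem coeFn_stieltjesSum {Z : ℝ → Ω → E} {Z' : ℝ → Lp E 2 P}
    (hZ : ∀ ν ∈ Set.Icc (-Real.pi) Real.pi, Z' ν =ᵐ[P] Z ν) (p : FreqPartition) (g : ℝ → ℂ) :
    stieltjesSum Z' p g =ᵐ[P] fun ω => stieltjesSum (fun ν => Z ν ω) p g := by
  simp only [stieltjesSum_apply]
  refine coeFn_sum_smul _ _ fun j hj => ?_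
  have hj' := Finset.mem_range.1 hj
  filter_upwards [Lp.coeFn_sub (Z' (p.point (j + 1))) (Z' (p.point j)), hZ _ (p.mem_Icc hj'),
    hZ _ (p.mem_Icc hj'.le)] with ω hsub hright hleft
  rw [hsub, Pi.sub_apply, hright, hleft]

theorem isStieltjesIntegral_iff_tendsto_Lp {g : ℝ → ℂ} {Z : ℝ → Ω → E} {Z' : ℝ → Lp E 2 P}
    (hZ : ∀ ν ∈ Set.Icc (-Real.pi) Real.pi, Z' ν =ᵐ[P] Z ν) {I : Ω → E} {F : Lp E 2 P}
    (hI : F =ᵐ[P] I) :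
    IsStieltjesIntegral P g Z I ↔ Tendsto (fun p => stieltjesSum Z' p g) fineMesh (𝓝 F) := by
  have hdist (p : FreqPartition) : ∫⁻ ω, ‖I ω - stieltjesSum (fun ν => Z ν ω) p g‖ₑ ^ 2 ∂P =
      edist (stieltjesSum Z' p g) F ^ 2 := by
    rw [edist_comm, edist_eq_enorm_sub, enorm_sq_eq_lintegral]
    refine lintegral_congr_ae ?_
    filter_upwards [Lp.coeFn_sub F (stieltjesSum Z' p g), hI, coeFn_stieltjesSum hZ p g]
      with ω hsub hF hsum
    rw [hsub, Pi.sub_apply, hF, hsum]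
  rw [isStieltjesIntegral_iff, and_iff_right ((memLp_congr_ae hI).1 (Lp.memLp F)),
    tendsto_iff_edist_tendsto_0]
  simp_rw [hdist]
  refine ⟨fun h => ?_, fun h => by simpa using ENNReal.Tendsto.pow (n := 2) h⟩
  have hroot (x : ℝ≥0∞) : (x ^ 2) ^ (1 / 2 : ℝ) = x := by
    rw [← ENNReal.rpow_natCast, ← ENNReal.rpow_mul]
    norm_num
  have hsqrt := h.ennrpow_const (1 / 2 : ℝ)
  rw [ENNReal.zero_rpow_of_pos (by norm_num)] at hsqrt
  simpa only [hroot] using hsqrt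

end MeanSquare

theorem tendsto_stieltjesSum_freqInd {g : ℝ → ℂ}
    (hg : ContinuousOn g (Set.Icc (-Real.pi) Real.pi)) {f : FreqL2} (hf : f =ᵐ[freqMeasure] g) :
    Tendsto (fun p => stieltjesSum freqInd p g) fineMesh (𝓝 f) := by
  set K : ℝ := (measureUnivNNReal freqMeasure : ℝ) ^ ((2 : ℝ≥0∞).toReal)⁻¹
  have hK : 0 ≤ K := by positivity
  refine (fineMesh_hasBasis.tendsto_iff Metric.nhds_basis_ball).2 fun ε hε => ?_
  have hε' : 0 < ε / (K + 1) := by positivity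
  obtain ⟨δ, hδ, hunif⟩ := Metric.uniformContinuousOn_iff.1
    ((isCompact_Icc (a := -Real.pi) (b := Real.pi)).uniformContinuousOn_of_continuous hg) _ hε'
  refine ⟨δ, hδ, fun p hp => ?_⟩
  have hnorm : ‖f - stieltjesSum freqInd p g‖ ≤ K * (ε / (K + 1)) := by
    refine Lp.norm_le_of_ae_bound hε'.le ?_
    filter_upwards [Lp.coeFn_sub f (stieltjesSum freqInd p g), hf,
      coeFn_stieltjesSum (fun ν _ => coeFn_freqInd ν) p g, ae_restrict_mem measurableSet_Ioc]
      with θ hsub hfθ hsum hθ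
    obtain ⟨j, hj, hmem⟩ := p.exists_mem_Ioc hθ
    rw [hsub, Pi.sub_apply, hfθ, hsum, stieltjesSum_indicator_Iic g hj hmem, ← dist_eq_norm]
    refine (hunif θ ⟨hθ.1.le, hθ.2⟩ _ (p.mem_Icc hj.le) ?_).le
    rw [Real.dist_eq, abs_of_pos (sub_pos.2 hmem.1)]
    linarith [hp j hj, hmem.2]
  rw [Metric.mem_ball, dist_comm, dist_eq_norm]
  refine hnorm.trans_lt ?_
  rw [mul_div_assoc', div_lt_iff₀ (by positivity)]
  nlinarith

/-! ### Processes with orthogonal increments -/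

/-- The process `Z_ν`, `-π ≤ ν ≤ π`, has orthogonal increments over intervals without common
interior points. -/
def HasOrthogonalIncrements {G : Type*} [NormedAddCommGroup G] [InnerProductSpace ℂ G]
    (Z : ℝ → G) : Prop :=
  ∀ ⦃a b c d : ℝ⦄, -Real.pi ≤ a → a ≤ b → b ≤ c → c ≤ d → d ≤ Real.pi →
    inner ℂ (Z b - Z a) (Z d - Z c) = 0

section OrthogonalIncrements

variable {G H : Type*} [NormedAddCommGroup G] [InnerProductSpace ℂ G] [NormedAddCommGroup H]
  [InnerProductSpace ℂ H]

theorem norm_sum_range_sq_of_orthogonal {D : ℕ → G} {J : ℕ} (w : ℕ → ℂ)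
    (h : ∀ i j, i < j → j < J → inner ℂ (D i) (D j) = 0) :
    ‖∑ j ∈ Finset.range J, w j • D j‖ ^ 2 = ∑ j ∈ Finset.range J, ‖w j‖ ^ 2 * ‖D j‖ ^ 2 := by
  induction J with
  | zero => simp
  | succ J ih =>
    have horth : inner ℂ (∑ j ∈ Finset.range J, w j • D j) (w J • D J) = 0 := by
      rw [sum_inner]
      refine Finset.sum_eq_zero fun j hj => ?_
      rw [inner_smul_left, inner_smul_right, h j J (Finset.mem_range.1 hj) (Nat.lt_succ_self J),
        mul_zero, mul_zero]
    rw [Finset.sum_range_succ, Finset.sum_range_succ, ← ih fun i j hij hj => h i j hij (by omega),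
      sq, norm_add_sq_eq_norm_sq_add_norm_sq_of_inner_eq_zero (𝕜 := ℂ) _ _ horth, norm_smul]
    ring

theorem hasOrthogonalIncrements_of_inner_eq_min {Z : ℝ → G} {F : ℝ → ℂ}
    (h : ∀ a ∈ Set.Icc (-Real.pi) Real.pi, ∀ b ∈ Set.Icc (-Real.pi) Real.pi,
      inner ℂ (Z a) (Z b) = F (min a b)) : HasOrthogonalIncrements Z := by
  intro a b c d ha hab hbc hcd hd
  have ha' : a ∈ Set.Icc (-Real.pi) Real.pi := ⟨ha, by linarith⟩
  have hb' : b ∈ Set.Icc (-Real.pi) Real.pi := ⟨by linarith, by linarith⟩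
  have hc' : c ∈ Set.Icc (-Real.pi) Real.pi := ⟨by linarith, by linarith⟩
  have hd' : d ∈ Set.Icc (-Real.pi) Real.pi := ⟨by linarith, hd⟩
  rw [inner_sub_left, inner_sub_right, inner_sub_right, h b hb' d hd', h b hb' c hc',
    h a ha' d hd', h a ha' c hc', min_eq_left (hbc.trans hcd), min_eq_left hbc,
    min_eq_left (hab.trans (hbc.trans hcd)), min_eq_left (hab.trans hbc)]
  ring

namespace HasOrthogonalIncrements

variable {Z : ℝ → G} {W : ℝ → H}

theorem norm_sub_sq (hZ : HasOrthogonalIncrements Z) (hZ0 : Z (-Real.pi) = 0) {a b : ℝ}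
    (ha : -Real.pi ≤ a) (hab : a ≤ b) (hb : b ≤ Real.pi) :
    ‖Z b - Z a‖ ^ 2 = ‖Z b‖ ^ 2 - ‖Z a‖ ^ 2 := by
  have horth : inner ℂ (Z a) (Z b - Z a) = 0 := by
    simpa [hZ0] using hZ le_rfl ha le_rfl hab hb
  have := norm_add_sq_eq_norm_sq_add_norm_sq_of_inner_eq_zero (𝕜 := ℂ) _ _ horth
  rw [add_sub_cancel] at this
  linarith

theorem norm_stieltjesSum_sq (hZ : HasOrthogonalIncrements Z) (hZ0 : Z (-Real.pi) = 0)
    (p : FreqPartition) (g : ℝ → ℂ) :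
    ‖stieltjesSum Z p g‖ ^ 2 = ∑ j ∈ Finset.range p.size,
      ‖g (p.point j)‖ ^ 2 * (‖Z (p.point (j + 1))‖ ^ 2 - ‖Z (p.point j)‖ ^ 2) := by
  rw [stieltjesSum_apply, norm_sum_range_sq_of_orthogonal (fun j => g (p.point j))
    fun i j hij hj => hZ (p.mem_Icc (by omega)).1 (p.lt i (by omega)).le
      (p.mono (by omega) hj.le) (p.lt j hj).le (p.mem_Icc hj).2]
  refine Finset.sum_congr rfl fun j hj => ?_
  have hj' := Finset.mem_range.1 hj
  rw [hZ.norm_sub_sq hZ0 (p.mem_Icc hj'.le).1 (p.lt j hj').le (p.mem_Icc hj').2]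

theorem norm_stieltjesSum_eq (hZ : HasOrthogonalIncrements Z) (hZ0 : Z (-Real.pi) = 0)
    (hW : HasOrthogonalIncrements W) (hW0 : W (-Real.pi) = 0)
    (h : ∀ ν ∈ Set.Icc (-Real.pi) Real.pi, ‖Z ν‖ = ‖W ν‖) (p : FreqPartition) (g : ℝ → ℂ) :
    ‖stieltjesSum Z p g‖ = ‖stieltjesSum W p g‖ := by
  rw [← sq_eq_sq₀ (norm_nonneg _) (norm_nonneg _), hZ.norm_stieltjesSum_sq hZ0,
    hW.norm_stieltjesSum_sq hW0]
  refine Finset.sum_congr rfl fun j hj => ?_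
  have hj' := Finset.mem_range.1 hj
  rw [h _ (p.mem_Icc hj'), h _ (p.mem_Icc hj'.le)]

end HasOrthogonalIncrements

theorem exists_tendsto_stieltjesSum_of_mem_span {A : FreqL2 →L[ℂ] G} {Z : ℝ → G}
    (hZ : ∀ t, Tendsto (fun p => stieltjesSum Z p (charFn t)) fineMesh (𝓝 (A (charL2 t))))
    {f : FreqL2} (hf : f ∈ Submodule.span ℂ (Set.range charL2)) :
    ∃ g : ℝ → ℂ, Tendsto (fun p => stieltjesSum freqInd p g) fineMesh (𝓝 f) ∧
      Tendsto (fun p => stieltjesSum Z p g) fineMesh (𝓝 (A f)) := by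
  induction hf using Submodule.span_induction with
  | mem f hf =>
    obtain ⟨t, rfl⟩ := hf
    exact ⟨charFn t, tendsto_stieltjesSum_freqInd (continuous_charFn t).continuousOn
      (coeFn_charL2 t), hZ t⟩
  | zero => exact ⟨0, by simp [tendsto_const_nhds], by simp [tendsto_const_nhds]⟩
  | add f₁ f₂ _ _ h₁ h₂ =>
    obtain ⟨g₁, hf₁, hA₁⟩ := h₁
    obtain ⟨g₂, hf₂, hA₂⟩ := h₂
    exact ⟨g₁ + g₂, by simpa only [map_add] using hf₁.add hf₂,
      by simpa only [map_add] using hA₁.add hA₂⟩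
  | smul c f _ h =>
    obtain ⟨g, hf, hA⟩ := h
    exact ⟨c • g, by simpa only [map_smul] using hf.const_smul c,
      by simpa only [map_smul] using hA.const_smul c⟩

theorem eq_apply_freqInd_of_tendsto {A : FreqL2 →L[ℂ] G} {Z : ℝ → G} (hZ0 : Z (-Real.pi) = 0)
    (hnorm : ∀ p g, ‖stieltjesSum Z p g‖ = ‖stieltjesSum (fun ν => A (freqInd ν)) p g‖)
    (hZ : ∀ t, Tendsto (fun p => stieltjesSum Z p (charFn t)) fineMesh (𝓝 (A (charL2 t))))
    {ν : ℝ} (hν : ν ∈ Set.Icc (-Real.pi) Real.pi) : Z ν = A (freqInd ν) := by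
  have := fineMesh_inf_principal_neBot hν
  have hspan : ∀ f ∈ Submodule.span ℂ (Set.range charL2), ‖A f - Z ν‖ = ‖A f - A (freqInd ν)‖ := by
    intro f hf
    obtain ⟨g, hf, hAf⟩ := exists_tendsto_stieltjesSum_of_mem_span hZ hf
    have hlim : Tendsto (fun p => ‖stieltjesSum Z p g - Z ν‖)
        (fineMesh ⊓ 𝓟 {p | ∃ k ≤ p.size, p.point k = ν}) (𝓝 ‖A f - Z ν‖) :=
      ((hAf.mono_left inf_le_left).sub_const _).norm
    have hlim' : Tendsto (fun p => ‖A (stieltjesSum freqInd p g) - A (freqInd ν)‖)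
        (fineMesh ⊓ 𝓟 {p | ∃ k ≤ p.size, p.point k = ν}) (𝓝 ‖A f - A (freqInd ν)‖) :=
      (((A.continuous.tendsto f).comp (hf.mono_left inf_le_left)).sub_const _).norm
    refine tendsto_nhds_unique (hlim.congr' ?_) hlim'
    filter_upwards [mem_inf_of_right (mem_principal_self _)]
    rintro p ⟨k, hk, rfl⟩
    have h := hnorm p (g - (Set.Iio (p.point k)).indicator 1)
    rw [map_sub, map_sub, stieltjesSum_indicator_Iio _ hk, stieltjesSum_indicator_Iio _ hk, hZ0,
      freqInd_neg_pi, map_zero, sub_zero, sub_zero] at h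
    rw [h]
    have hA := map_stieltjesSum A.toLinearMap freqInd p g
    exact congrArg (fun y => ‖y - A (freqInd (p.point k))‖) hA.symm
  have hclosed : IsClosed {f | ‖A f - Z ν‖ = ‖A f - A (freqInd ν)‖} :=
    isClosed_eq (by fun_prop) (by fun_prop)
  have hdense := Submodule.dense_iff_topologicalClosure_eq_top.2 topologicalClosure_span_charL2
  have h : ‖A (freqInd ν) - Z ν‖ = ‖A (freqInd ν) - A (freqInd ν)‖ :=
    hdense.induction (P := fun f => ‖A f - Z ν‖ = ‖A f - A (freqInd ν)‖) hspan hclosed (freqInd ν)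
  rw [sub_self, norm_zero, norm_sub_eq_zero_iff] at h
  exact h.symm

end OrthogonalIncrements

/-! ### The Cramér process of the field -/

theorem inner_eq_integral_of_ae_eq {Ω E : Type*} [MeasurableSpace Ω] {P : Measure Ω}
    [NormedAddCommGroup E] [InnerProductSpace ℂ E] {F G : Lp E 2 P} {f g : Ω → E}
    (hf : F =ᵐ[P] f) (hg : G =ᵐ[P] g) : inner ℂ F G = ∫ ω, inner ℂ (f ω) (g ω) ∂P := by
  rw [L2.inner_def]
  exact integral_congr_ae (by filter_upwards [hf, hg] with ω hω hω'; rw [hω, hω'])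

theorem freqIcc_left_mem : -Real.pi ∈ Set.Icc (-Real.pi) Real.pi :=
  Set.left_mem_Icc.2 (neg_le_self Real.pi_pos.le)

section CramerProcess

variable {Ω : Type*} [MeasurableSpace Ω] {P : Measure Ω} {T : Sph2 → ℤ → Ω → ℝ}
  {Y : ℕ → ℤ → Sph2 → ℂ}

section TotalDensity

variable (hS : Summable fun p : HarmIndex × ℤ => ‖angularCov P Y T p.1.1 p.2‖)

include hS in
theorem summable_norm_angularCov_fst (i : HarmIndex) :
    Summable fun t : ℤ => ‖angularCov P Y T i.1 t‖ :=
  Summable.prod_factor (f := fun p : HarmIndex × ℤ => ‖angularCov P Y T p.1.1 p.2‖) hS i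

/-- The density `∑_l (2l+1) f_l` of the spectral measure of the `L²`-valued process `T_t`. -/
noncomputable def totalSpecDensity : Lp ℂ ∞ freqMeasure :=
  ∑' i : HarmIndex, specDensity (summable_norm_angularCov_fst hS i)

theorem hasSum_specDensity :
    HasSum (fun i : HarmIndex => specDensity (summable_norm_angularCov_fst hS i))
      (totalSpecDensity hS) :=
  (Summable.of_norm_bounded ((Summable.prod
    (f := fun p : HarmIndex × ℤ => ‖angularCov P Y T p.1.1 p.2‖) hS).mul_left (2 * Real.pi)⁻¹)
    fun i => norm_specDensity_le (summable_norm_angularCov_fst hS i)).hasSum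

theorem hasSum_inner_freqMul_specDensity (f g : FreqL2) :
    HasSum
      (fun i : HarmIndex => inner ℂ f (freqMul (specDensity (summable_norm_angularCov_fst hS i)) g))
      (inner ℂ f (freqMul (totalSpecDensity hS) g)) :=
  ((innerSL ℂ f).comp (freqMul.flip g)).hasSum (hasSum_specDensity hS)

end TotalDensity

namespace IsIsotropicStationary

variable [SFinite P] (hT : IsIsotropicStationary P T) (hY : IsSphericalHarmonicBasis Y)

section SpectralRepresentation

variable (hcont : ∀ t : ℤ, Continuous fun p : Sph2 × Sph2 => autocovKernel P T t p.1 p.2)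
  (hS : Summable fun p : HarmIndex × ℤ => ‖angularCov P Y T p.1.1 p.2‖)

include hcont

theorem inner_toL2 (s t : ℤ) : inner ℂ (hT.toL2 hY s) (hT.toL2 hY t) =
    inner ℂ (charL2 s) (freqMul (totalSpecDensity hS) (charL2 t)) := by
  have hcoeff (i : HarmIndex) :
      inner ℂ (innerLp P (hY.hilbertBasis i) (hT.toL2 hY s))
        (innerLp P (hY.hilbertBasis i) (hT.toL2 hY t)) =
      inner ℂ (charL2 s)
        (freqMul (specDensity (summable_norm_angularCov_fst hS i)) (charL2 t)) := by
    rw [inner_charL2_freqMul_specDensity, hY.hilbertBasis_apply]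
    exact (hT.inner_coeff hY hcont i i t s).trans (if_pos rfl)
  have hfield := hasSum_inner_innerLp hY.hilbertBasis (hT.toL2 hY s) (hT.toL2 hY t)
  simp_rw [hcoeff] at hfield
  exact hfield.unique (hasSum_inner_freqMul_specDensity hS _ _)

include hS

theorem spectralOp_toL2 (t : ℤ) : spectralOp (hT.toL2 hY) (charL2 t) = hT.toL2 hY t :=
  spectralOp_charL2 (hT.inner_toL2 hY hcont hS) t

theorem inner_innerLp_spectralOp (i j : HarmIndex) (f g : FreqL2) :
    inner ℂ (innerLp P (hY.toL2 i) (spectralOp (hT.toL2 hY) f))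
      (innerLp P (hY.toL2 j) (spectralOp (hT.toL2 hY) g)) =
    if j = i then inner ℂ f (freqMul (specDensity (summable_norm_angularCov_fst hS i)) g)
    else 0 := by
  have h := inner_apply_eq_of_charL2
    (A := (innerLp P (hY.toL2 i)).comp (spectralOp (hT.toL2 hY)))
    (A' := (innerLp P (hY.toL2 j)).comp (spectralOp (hT.toL2 hY)))
    (B := if j = i then freqMul (specDensity (summable_norm_angularCov_fst hS i)) else 0)
    (fun s t => by
      rw [ContinuousLinearMap.comp_apply, ContinuousLinearMap.comp_apply,
        hT.spectralOp_toL2 hY hcont hS, hT.spectralOp_toL2 hY hcont hS]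
      refine (hT.inner_coeff hY hcont j i t s).trans ?_
      split_ifs
      · exact (inner_charL2_freqMul_specDensity _ s t).symm
      · exact (inner_zero_right _).symm) f g
  refine h.trans ?_
  split_ifs
  · rfl
  · exact inner_zero_right _

theorem hasSum_inner_spectralOp (f g : FreqL2) :
    HasSum
      (fun i : HarmIndex => inner ℂ f (freqMul (specDensity (summable_norm_angularCov_fst hS i)) g))
      (inner ℂ (spectralOp (hT.toL2 hY) f) (spectralOp (hT.toL2 hY) g)) := by
  have h := hasSum_inner_innerLp hY.hilbertBasis (spectralOp (hT.toL2 hY) f)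
    (spectralOp (hT.toL2 hY) g)
  simpa only [hY.hilbertBasis_apply, hT.inner_innerLp_spectralOp hY hcont hS, if_true] using h

end SpectralRepresentation

/-- The Cramér process of the field: `Z_ν` is the image of the indicator of `(-π, ν]` under the
operator that maps the character `ν ↦ e^{itν}` to `T_t`. -/
noncomputable def cramer (ν : ℝ) : Lp SphL2 2 P := spectralOp (hT.toL2 hY) (freqInd ν)

theorem cramer_neg_pi : hT.cramer hY (-Real.pi) = 0 := by
  rw [cramer, freqInd_neg_pi, map_zero]

variable (hcont : ∀ t : ℤ, Continuous fun p : Sph2 × Sph2 => autocovKernel P T t p.1 p.2)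
  (hS : Summable fun p : HarmIndex × ℤ => ‖angularCov P Y T p.1.1 p.2‖)

include hcont hS

theorem hasSum_inner_cramer {a b : ℝ} (ha : a ∈ Set.Icc (-Real.pi) Real.pi)
    (hb : b ∈ Set.Icc (-Real.pi) Real.pi) :
    HasSum (fun i : HarmIndex => ∫ θ in (-Real.pi)..min a b, spectralDensity P Y T i.1 θ)
      (inner ℂ (hT.cramer hY a) (hT.cramer hY b)) := by
  have h := hT.hasSum_inner_spectralOp hY hcont hS (freqInd a) (freqInd b)
  simp only [inner_freqInd_freqMul_specDensity _ ha hb] at h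
  exact h

theorem hasSum_norm_cramer {ν : ℝ} (hν : ν ∈ Set.Icc (-Real.pi) Real.pi) :
    HasSum (fun l : ℕ => (2 * l + 1 : ℂ) * ∫ θ in (-Real.pi)..ν, spectralDensity P Y T l θ)
      ((‖hT.cramer hY ν‖ ^ 2 : ℝ) : ℂ) := by
  have h := hT.hasSum_inner_cramer hY hcont hS hν hν
  rw [min_self, inner_self_eq_norm_sq_to_K] at h
  have h' := HarmIndex.hasSum_fst
    (g := fun l => ∫ θ in (-Real.pi)..ν, spectralDensity P Y T l θ) h
  simp only [nsmul_eq_mul, Nat.cast_add, Nat.cast_mul, Nat.cast_ofNat, Nat.cast_one] at h'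
  rw [Complex.ofReal_pow]
  exact h'

theorem hasOrthogonalIncrements_cramer : HasOrthogonalIncrements (hT.cramer hY) :=
  hasOrthogonalIncrements_of_inner_eq_min
    (F := fun c => ∑' i : HarmIndex, ∫ θ in (-Real.pi)..c, spectralDensity P Y T i.1 θ)
    fun _ ha _ hb => (hT.hasSum_inner_cramer hY hcont hS ha hb).tsum_eq.symm

theorem tendsto_stieltjesSum_cramer (t : ℤ) :
    Tendsto (fun p => stieltjesSum (hT.cramer hY) p (charFn t)) fineMesh
      (𝓝 (hT.toL2 hY t)) := by
  have h := ((spectralOp (hT.toL2 hY)).continuous.tendsto _).comp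
    (tendsto_stieltjesSum_freqInd (continuous_charFn t).continuousOn (coeFn_charL2 t))
  rw [hT.spectralOp_toL2 hY hcont hS] at h
  exact h.congr fun p => map_stieltjesSum (spectralOp (hT.toL2 hY)).toLinearMap _ _ _

theorem isCramerProcess_cramer : IsCramerProcess P Y T fun ν => hT.cramer hY ν where
  memLp _ _ := Lp.memLp _
  hasSum_norm ν hν := by
    rw [← norm_sq_eq_integral]
    exact hT.hasSum_norm_cramer hY hcont hS hν
  orthogonal ν₁ h₁ ν₂ _ ν₃ _ ν₄ h₄ h21 h32 h43 := by
    rw [← hT.hasOrthogonalIncrements_cramer hY hcont hS h₄.1 h43.le h32 h21.le h₁.2]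
    exact (inner_eq_integral_of_ae_eq (Lp.coeFn_sub _ _) (Lp.coeFn_sub _ _)).symm
  representation t :=
    (isStieltjesIntegral_iff_tendsto_Lp (fun _ _ => EventuallyEq.rfl) (hT.coeFn_toL2 hY t)).2
      (hT.tendsto_stieltjesSum_cramer hY hcont hS t)

end IsIsotropicStationary

/-! ### Uniqueness of the Cramér process and its harmonic coefficients -/

omit [MeasurableSpace Ω] in
theorem IsSphericalHarmonicBasis.inner_toL2_eq_incrementCoeff (hY : IsSphericalHarmonicBasis Y)
    (Z : ℝ → Ω → SphL2) (i : HarmIndex) (ν : ℝ) (ω : Ω) :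
    inner ℂ (hY.toL2 i) (Z ν ω) = incrementCoeff Y Z i.1 i.2 ν ω :=
  hY.inner_toL2 i _

namespace IsCramerProcess

variable {Z : ℝ → Ω → SphL2} (hZ : IsCramerProcess P Y T Z)

open Classical in
/-- The values of a Cramér process as elements of `L²(Ω; L²)`; outside `[-π, π]` they are set
to `0`. -/
noncomputable def toL2 (ν : ℝ) : Lp SphL2 2 P :=
  if h : ν ∈ Set.Icc (-Real.pi) Real.pi then (hZ.memLp ν h).toLp (Z ν) else 0

theorem coeFn_toL2 {ν : ℝ} (hν : ν ∈ Set.Icc (-Real.pi) Real.pi) : hZ.toL2 ν =ᵐ[P] Z ν := by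
  rw [toL2, dif_pos hν]
  exact MemLp.coeFn_toLp _

theorem hasSum_norm_toL2 {ν : ℝ} (hν : ν ∈ Set.Icc (-Real.pi) Real.pi) :
    HasSum (fun l : ℕ => (2 * l + 1 : ℂ) * ∫ θ in (-Real.pi)..ν, spectralDensity P Y T l θ)
      ((‖hZ.toL2 ν‖ ^ 2 : ℝ) : ℂ) := by
  rw [norm_sq_eq_integral,
    integral_congr_ae ((hZ.coeFn_toL2 hν).mono fun ω hω => congrArg (‖·‖ ^ 2) hω)]
  exact hZ.hasSum_norm ν hν

theorem toL2_neg_pi : hZ.toL2 (-Real.pi) = 0 := by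
  have h := hZ.hasSum_norm_toL2 freqIcc_left_mem
  simp only [intervalIntegral.integral_same, mul_zero] at h
  simpa using h.unique hasSum_zero

theorem hasOrthogonalIncrements_toL2 : HasOrthogonalIncrements hZ.toL2 := by
  intro a b c d ha hab hbc hcd hd
  have ha' : a ∈ Set.Icc (-Real.pi) Real.pi := ⟨ha, by linarith⟩
  have hb' : b ∈ Set.Icc (-Real.pi) Real.pi := ⟨by linarith, by linarith⟩
  have hc' : c ∈ Set.Icc (-Real.pi) Real.pi := ⟨by linarith, by linarith⟩
  have hd' : d ∈ Set.Icc (-Real.pi) Real.pi := ⟨by linarith, hd⟩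
  rcases hab.eq_or_lt with rfl | hab
  · rw [sub_self, inner_zero_left]
  rcases hcd.eq_or_lt with rfl | hcd
  · rw [sub_self, inner_zero_right]
  rw [← hZ.orthogonal d hd' c hc' b hb' a ha' hcd hbc hab]
  exact inner_eq_integral_of_ae_eq
    ((Lp.coeFn_sub _ _).trans ((hZ.coeFn_toL2 hb').sub (hZ.coeFn_toL2 ha')))
    ((Lp.coeFn_sub _ _).trans ((hZ.coeFn_toL2 hd').sub (hZ.coeFn_toL2 hc')))

theorem tendsto_stieltjesSum_toL2 {t : ℤ} {F : Lp SphL2 2 P} (hF : F =ᵐ[P] fieldElement T t) :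
    Tendsto (fun p => stieltjesSum hZ.toL2 p (charFn t)) fineMesh (𝓝 F) :=
  (isStieltjesIntegral_iff_tendsto_Lp (fun _ hν => hZ.coeFn_toL2 hν) hF).1 (hZ.representation t)

theorem coeFn_innerLp_toL2 (hY : IsSphericalHarmonicBasis Y) (i : HarmIndex) {ν : ℝ}
    (hν : ν ∈ Set.Icc (-Real.pi) Real.pi) :
    innerLp P (hY.toL2 i) (hZ.toL2 ν) =ᵐ[P] incrementCoeff Y Z i.1 i.2 ν := by
  filter_upwards [coeFn_innerLp (hY.toL2 i) (hZ.toL2 ν), hZ.coeFn_toL2 hν] with ω hinner hω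
  rw [hinner, hω, hY.inner_toL2_eq_incrementCoeff]

variable [SFinite P] (hT : IsIsotropicStationary P T) (hY : IsSphericalHarmonicBasis Y)

include hZ hT hY in
theorem isStieltjesIntegral_harmonicCoeff (i : HarmIndex) (t : ℤ) :
    IsStieltjesIntegral P (charFn t) (incrementCoeff Y Z i.1 i.2)
      (harmonicCoeff Y T i.1 i.2 t) := by
  refine (isStieltjesIntegral_iff_tendsto_Lp (fun _ hν => hZ.coeFn_innerLp_toL2 hY i hν)
    (hT.coeFn_coeff hY i t)).2 ?_
  have h := ((innerLp P (hY.toL2 i)).continuous.tendsto _).comp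
    (hZ.tendsto_stieltjesSum_toL2 (hT.coeFn_toL2 hY t))
  exact h.congr fun p => map_stieltjesSum (innerLp P (hY.toL2 i)).toLinearMap _ _ _

variable (hcont : ∀ t : ℤ, Continuous fun p : Sph2 × Sph2 => autocovKernel P T t p.1 p.2)
  (hS : Summable fun p : HarmIndex × ℤ => ‖angularCov P Y T p.1.1 p.2‖)

include hcont hS

theorem toL2_eq_cramer {ν : ℝ} (hν : ν ∈ Set.Icc (-Real.pi) Real.pi) :
    hZ.toL2 ν = hT.cramer hY ν := by
  have hnorm : ∀ β ∈ Set.Icc (-Real.pi) Real.pi, ‖hZ.toL2 β‖ = ‖hT.cramer hY β‖ := by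
    intro β hβ
    rw [← sq_eq_sq₀ (norm_nonneg _) (norm_nonneg _), ← Complex.ofReal_inj]
    exact (hZ.hasSum_norm_toL2 hβ).unique (hT.hasSum_norm_cramer hY hcont hS hβ)
  refine eq_apply_freqInd_of_tendsto hZ.toL2_neg_pi
    (hZ.hasOrthogonalIncrements_toL2.norm_stieltjesSum_eq hZ.toL2_neg_pi
      (hT.hasOrthogonalIncrements_cramer hY hcont hS) (hT.cramer_neg_pi hY) hnorm)
    (fun t => ?_) hν
  rw [hT.spectralOp_toL2 hY hcont hS]
  exact hZ.tendsto_stieltjesSum_toL2 (hT.coeFn_toL2 hY t)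

include hZ hT hY

theorem integral_incrementCoeff (i j : HarmIndex) {ν β : ℝ}
    (hν : ν ∈ Set.Icc (-Real.pi) Real.pi) (hβ : β ∈ Set.Icc (-Real.pi) Real.pi) :
    ∫ ω, incrementCoeff Y Z i.1 i.2 ν ω * conj (incrementCoeff Y Z j.1 j.2 β ω) ∂P =
      if i = j then ∫ θ in (-Real.pi)..min ν β, spectralDensity P Y T i.1 θ else 0 := by
  have h := inner_eq_integral_of_ae_eq (hZ.coeFn_innerLp_toL2 hY j hβ)
    (hZ.coeFn_innerLp_toL2 hY i hν)
  simp only [RCLike.inner_apply] at h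
  rw [← h, hZ.toL2_eq_cramer hT hY hcont hS hν, hZ.toL2_eq_cramer hT hY hcont hS hβ]
  refine (hT.inner_innerLp_spectralOp hY hcont hS j i _ _).trans ?_
  split_ifs with hij
  · rw [inner_freqInd_freqMul_specDensity _ hβ hν, min_comm, hij]
  · rfl

end IsCramerProcess

end CramerProcess

theorem mainTheorem7_general {Ω : Type*} [MeasurableSpace Ω] (P : Measure Ω) [SFinite P]
    (Y : ℕ → ℤ → Sph2 → ℂ) (hY : IsSphericalHarmonicBasis Y)
    (T : Sph2 → ℤ → Ω → ℝ) (hT : IsIsotropicStationary P T)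
    (hcont : ∀ t : ℤ, Continuous fun p : Sph2 × Sph2 => autocovKernel P T t p.1 p.2)
    (hsum : ∑' t : ℤ, traceNorm (kernelOperator (autocovKernel P T t) (hcont t)) < ∞) :
    (∃ Z : ℝ → Ω → SphL2, IsCramerProcess P Y T Z) ∧
    ∀ Z : ℝ → Ω → SphL2, IsCramerProcess P Y T Z →
      (∃ I : ℕ → ℤ → ℤ → Ω → ℂ,
        (∀ (l : ℕ) (m t : ℤ), |m| ≤ l →
          IsStieltjesIntegral P (charFn t) (incrementCoeff Y Z l m) (I l m t)) ∧
        ∀ (t : ℤ) (x : Sph2), Tendsto (fun L : ℕ =>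
          ∫⁻ ω, ‖(T x t ω : ℂ) - ∑ l ∈ Finset.range (L + 1), ∑ m ∈ Finset.Icc (-(l : ℤ)) l,
            I l m t ω * Y l m x‖ₑ ^ 2 ∂P) atTop (𝓝 0)) ∧
      ∀ (l l' : ℕ) (m m' : ℤ), |m| ≤ l → |m'| ≤ l' →
        ∀ ν ∈ Set.Icc (-Real.pi) Real.pi, ∀ β ∈ Set.Icc (-Real.pi) Real.pi,
          ∫ ω, incrementCoeff Y Z l m ν ω * conj (incrementCoeff Y Z l' m' β ω) ∂P =
            if l = l' ∧ m = m' then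
              ∫ θ in (-Real.pi)..(min ν β), spectralDensity P Y T l θ
            else 0 := by
  have hS := hT.summable_angularCov hY hcont hsum
  refine ⟨⟨_, hT.isCramerProcess_cramer hY hcont hS⟩, fun Z hZ =>
    ⟨⟨harmonicCoeff Y T, fun l m t hm => ?_, fun t x => hT.tendsto_expansion hY hcont t x⟩,
      fun l l' m m' hm hm' ν hν β hβ => ?_⟩⟩
  · exact hZ.isStieltjesIntegral_harmonicCoeff hT hY (.mk hm) t
  · exact (hZ.integral_incrementCoeff hT hY hcont hS (.mk hm) (.mk hm') hν hβ).trans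
      (if_congr HarmIndex.ext_iff rfl rfl)

theorem mainTheorem7 {Ω : Type*} [MeasurableSpace Ω] (P : Measure Ω) [IsProbabilityMeasure P]
    (Y : ℕ → ℤ → Sph2 → ℂ) (hY : IsSphericalHarmonicBasis Y)
    (T : Sph2 → ℤ → Ω → ℝ) (hT : IsIsotropicStationary P T)
    (hcont : ∀ t : ℤ, Continuous fun p : Sph2 × Sph2 => autocovKernel P T t p.1 p.2)
    (hsum : ∑' t : ℤ, traceNorm (kernelOperator (autocovKernel P T t) (hcont t)) < ∞) :
    (∃ Z : ℝ → Ω → SphL2, IsCramerProcess P Y T Z) ∧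
    ∀ Z : ℝ → Ω → SphL2, IsCramerProcess P Y T Z →
      (∃ I : ℕ → ℤ → ℤ → Ω → ℂ,
        (∀ (l : ℕ) (m t : ℤ), |m| ≤ l →
          IsStieltjesIntegral P (charFn t) (incrementCoeff Y Z l m) (I l m t)) ∧
        ∀ (t : ℤ) (x : Sph2), Tendsto (fun L : ℕ =>
          ∫⁻ ω, ‖(T x t ω : ℂ) - ∑ l ∈ Finset.range (L + 1), ∑ m ∈ Finset.Icc (-(l : ℤ)) l,
            I l m t ω * Y l m x‖ₑ ^ 2 ∂P) atTop (𝓝 0)) ∧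
      ∀ (l l' : ℕ) (m m' : ℤ), |m| ≤ l → |m'| ≤ l' →
        ∀ ν ∈ Set.Icc (-Real.pi) Real.pi, ∀ β ∈ Set.Icc (-Real.pi) Real.pi,
          ∫ ω, incrementCoeff Y Z l m ν ω * conj (incrementCoeff Y Z l' m' β ω) ∂P =
            if l = l' ∧ m = m' then
              ∫ θ in (-Real.pi)..(min ν β), spectralDensity P Y T l θ
            else 0 :=
  mainTheorem7_general P Y hY T hT hcont hsum
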